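/- For $n\in\mathbb N$ let $B_n=\{-n,\dots,n\}^2\subset\mathbb Z^2$ and $\mathbb S=\mathbb R/2\pi\mathbb Z$. A configuration $\hat\eta$ assigns to each site $x$ either no particle, or one active particle, or one passive particle; a particle at $x$ carries an angle $\theta_x\in\mathbb S$. Write $\eta^a_x,\eta^p_x\in\{0,1\}$ for the numbers of active and passive particles at $x$, $\eta_x=\eta^a_x+\eta^p_x$, and, for $\omega:\mathbb S\to\mathbb R$ and $\sigma\in\{a,p\}$, $\eta^{\sigma,\omega}_x=\omega(\theta_x)\eta^\sigma_x$. A cylinder function is a real function of the configuration on $\mathbb Z^2$ that depends on finitely many sites only and is $C^2$ in each angle. Let $T^\omega$ be the linear span of the cylinder functions of the form $$f(\hat\eta)=\sum_{x\in\mathbb Z^2}\big(a\eta^a_x+b\eta^p_x+c\,\eta^{a,\omega}_x+d\,\eta^{p,\omega}_x\big)F_x(\eta),$$ where $a,b,c,d\in\mathbb R$ and each $F_x$ is independent of the types and the angles of the particles (it sees only which sites are occupied), and let $T^\omega_n$ be the set of those $f\in T^\omega$ that are cylinder functions depending only on the sites of $B_n$. A canonical state $\widehat K=(K^a,\Theta^a,K^p,\Theta^p)$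 on $B_n$ consists of the numbers $K^a,K^p$ of active and passive particles, $K^a+K^p\le|B_n|$, and of the multisets $\Theta^a,\Theta^p$ of their angles. Let $\mu_{n,\widehat K}$ be the canonical measure, i.e. the uniform distribution on the finite set of configurations on $B_n$ whose active (resp. passive) particles have exactly the angles $\Theta^a$ (resp. $\Theta^p$), let $\mathbb E_{n,\widehat K}$ be its expectation, and put $\alpha^\sigma=K^\sigma/|B_n|$. Let $$\mathcal L_nf(\hat\eta)=\sum_{x\in B_n}\ \sum_{|z|=1,\ x+z\in B_n}\eta_x(1-\eta_{x+z})\big(f(\hat\eta^{x,x+z})-f(\hat\eta)\big)$$ be the generator of the symmetric simple exclusion process in $B_n$, where $|\cdot|$ is the Manhattan norm and $\hat\eta^{x,y}$ is $\hat\eta$ with the states of $x$ and $y$ exchanged, and let $\mathcal D_{n,\widehat K}(f)=\mathbb E_{n,\widehat K}[f\,(-\mathcal L_nf)]$. **Proposition 5.6 (spectral gap).** For every $\alpha'\in[0,1)$ there is a constant $C(\alpha')$, depending only on $\alpha'$, such that for every $\omega:\mathbb S\to\mathbb R$, every $n$, every canonical state $\widehat K$ on $B_n$ with $\alpha^a+\alpha^p\le\alpha'$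 and every $f\in T^\omega_n$ with $\mathbb E_{n,\widehat K}[f]=0$, $$\mathbb E_{n,\widehat K}[f^2]\le C(\alpha')\,n^2\,\mathcal D_{n,\widehat K}(f).$$ -/

import Mathlib

namespace APLG

/-- The state of one site: empty, or occupied by an active or a passive particle which carries an
angle in `ℝ / 2πℤ`.  (The default angle `0` of an empty site carries no information.) -/
inductive Site where
  | empty : Site
  | active (θ : Real.Angle) : Site
  | passive (θ : Real.Angle) : Site

namespace Site

/-- Number of active particles, `η^a`. -/
def etaA : Site → ℝ
  | active _ => 1
  | _ => 0

/-- Number of passive particles, `η^p`. -/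
def etaP : Site → ℝ
  | passive _ => 1
  | _ => 0

/-- Total number of particles, `η = η^a + η^p`. -/
def eta (s : Site) : ℝ := s.etaA + s.etaP

/-- The angle, with the convention `0` at an empty site. -/
noncomputable def angle : Site → Real.Angle
  | empty => 0
  | active θ => θ
  | passive θ => θ

/-- The angle of an active particle as a multiset; it stands for the point measure `η^a δ_θ`. -/
def activeAngles : Site → Multiset Real.Angle
  | active θ => {θ}
  | _ => 0

/-- The angle of a passive particle as a multiset; it stands for the point measure `η^p δ_θ`. -/
def passiveAngles : Site → Multiset Real.Angle
  | passive θ => {θ}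
  | _ => 0

end Site

/-- Configurations on a set of sites `ι`. -/
abbrev Config (ι : Type) : Type := ι → Site

/-- Configurations on the infinite lattice `ℤ²`. -/
abbrev ConfigZ2 : Type := Config (ℤ × ℤ)

/-- Local functions which are `C²` in the angle of each particle. -/
def IsCylinder (f : ConfigZ2 → ℝ) : Prop :=
  (∃ s : Finset (ℤ × ℤ), DependsOn f (s : Set (ℤ × ℤ))) ∧
  ∀ (η : ConfigZ2) (x : ℤ × ℤ),
    ContDiff ℝ 2 (fun t : ℝ => f (Function.update η x (Site.active (t : Real.Angle)))) ∧
    ContDiff ℝ 2 (fun t : ℝ => f (Function.update η x (Site.passive (t : Real.Angle))))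

/-- `F` is independent of type and angle at `x`. -/
def IsITA (x : ℤ × ℤ) (F : ConfigZ2 → ℝ) : Prop :=
  ∃ f g : ConfigZ2 → ℝ, DependsOn f ({x}ᶜ : Set (ℤ × ℤ)) ∧
    ∀ η, F η = (η x).eta * f η + (1 - (η x).eta) * g η

/-- The angle-blind and type-blind functions. -/
def blindFunctions : Set (ConfigZ2 → ℝ) := {F | ∀ x, IsITA x F}

/-- The class `T^ω`: the span of the cylinder functions of the form
`∑_x (a η^a_x + b η^p_x + c η^{a,ω}_x + d η^{p,ω}_x) F_x(η)` with `F_x` angle- and type-blind. -/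
def classT (ω : Real.Angle → ℝ) : Submodule ℝ (ConfigZ2 → ℝ) :=
  Submodule.span ℝ {f | IsCylinder f ∧
    ∃ (a b c d : ℝ) (F : ℤ × ℤ → ConfigZ2 → ℝ), (∀ x, F x ∈ blindFunctions) ∧
      ∀ η : ConfigZ2, HasSum (fun x : ℤ × ℤ =>
        (a * (η x).etaA + b * (η x).etaP
          + c * (ω (η x).angle * (η x).etaA) + d * (ω (η x).angle * (η x).etaP)) * F x η) (f η)}

/-- The box `B_n = {-n, …, n}²` of side length `2n+1`. -/
noncomputable def box (n : ℕ) : Finset (ℤ × ℤ) := Finset.Icc (-(n : ℤ), -(n : ℤ)) ((n : ℤ), (n : ℤ))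

/-- The class `T^ω_n` of the functions of `T^ω` that are cylinder functions supported in `B_n`. -/
def classTn (ω : Real.Angle → ℝ) (n : ℕ) : Set (ConfigZ2 → ℝ) :=
  {f | f ∈ classT ω ∧ IsCylinder f ∧ DependsOn f (box n : Set (ℤ × ℤ))}

/-- The image on `B_n`-configurations of a function on the infinite configurations: sites outside
`B_n` are taken to be empty (they are irrelevant to a function supported in `B_n`). -/
noncomputable def onBox (n : ℕ) (f : ConfigZ2 → ℝ) (η : Config (box n)) : ℝ :=
  f (fun x => if h : x ∈ box n then η ⟨x, h⟩ else Site.empty)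

/-- A canonical state in `B_n`: the angles, with multiplicity, of the active and of the passive
particles; the particle numbers are the cardinalities. -/
structure CanonicalState (n : ℕ) where
  thetaA : Multiset Real.Angle
  thetaP : Multiset Real.Angle
  card_le : thetaA.card + thetaP.card ≤ (box n).card

namespace CanonicalState

variable {n : ℕ}

/-- The density `α^a` of active particles. -/
noncomputable def alphaA (K : CanonicalState n) : ℝ := (K.thetaA.card : ℝ) / ((box n).card : ℝ)

/-- The density `α^p` of passive particles. -/
noncomputable def alphaP (K : CanonicalState n) : ℝ := (K.thetaP.card : ℝ) / ((box n).card : ℝ)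

/-- The hyperplane of the configurations on `B_n` with canonical state `K`. -/
def hyperplane (K : CanonicalState n) : Set (Config (box n)) :=
  {η | ∑ x, (η x).activeAngles = K.thetaA ∧ ∑ x, (η x).passiveAngles = K.thetaP}

theorem hyperplane_finite (K : CanonicalState n) : K.hyperplane.Finite := by
  classical
  have hfin : (({Site.empty} ∪ Site.active '' {θ | θ ∈ K.thetaA}) ∪
      Site.passive '' {θ | θ ∈ K.thetaP} : Set Site).Finite := by
    refine ((Set.finite_singleton _).union (Set.Finite.image _ ?_)).union (Set.Finite.image _ ?_)
    · exact (Multiset.finite_toSet K.thetaA)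
    · exact (Multiset.finite_toSet K.thetaP)
  refine (Set.Finite.pi' (fun _ : box n => hfin)).subset ?_
  rintro η ⟨ha, hp⟩ x
  have h1 : (η x).activeAngles ≤ K.thetaA := by
    rw [← ha]
    exact Finset.single_le_sum (f := fun y => (η y).activeAngles) (fun _ _ => Multiset.zero_le _)
      (Finset.mem_univ x)
  have h2 : (η x).passiveAngles ≤ K.thetaP := by
    rw [← hp]
    exact Finset.single_le_sum (f := fun y => (η y).passiveAngles) (fun _ _ => Multiset.zero_le _)
      (Finset.mem_univ x)
  cases hx : η x with
  | empty => exact Or.inl (Or.inl rfl)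
  | active θ =>
    rw [hx] at h1
    exact Or.inl (Or.inr ⟨θ, Multiset.singleton_le.mp h1, rfl⟩)
  | passive θ =>
    rw [hx] at h2
    exact Or.inr ⟨θ, Multiset.singleton_le.mp h2, rfl⟩

theorem hyperplane_nonempty (K : CanonicalState n) : K.hyperplane.Nonempty := by
  classical
  set M : Multiset Site := K.thetaA.map Site.active + K.thetaP.map Site.passive
    + Multiset.replicate ((box n).card - (K.thetaA.card + K.thetaP.card)) Site.empty with hM
  have hcard : M.toList.length = Fintype.card (box n) := by
    have := K.card_le
    simp [hM]
    omega
  let e : box n ≃ Fin M.toList.length := Fintype.equivFinOfCardEq hcard.symm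
  have key : ∀ g : Site → Multiset Real.Angle,
      ∑ x, g (M.toList.get (e x)) = (M.map g).sum := by
    intro g
    rw [Equiv.sum_comp e (fun i => g (M.toList.get i))]
    conv_rhs => rw [← Multiset.coe_toList M, Multiset.map_coe, Multiset.sum_coe]
    rw [← List.sum_ofFn]
    congr 1
    apply List.ext_get <;> simp
  refine ⟨fun x => M.toList.get (e x), ?_, ?_⟩
  · rw [key, hM]
    simp [Function.comp_def, Site.activeAngles]
  · rw [key, hM]
    simp [Function.comp_def, Site.passiveAngles]

/-- Expectation under the canonical measure, which is the uniform distribution on the (finite,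
non-empty) hyperplane: the i.i.d. measure with uniform angles, conditioned on the hyperplane. -/
noncomputable def expect (K : CanonicalState n) (g : Config (box n) → ℝ) : ℝ :=
  (∑ η ∈ K.hyperplane_finite.toFinset, g η) / (K.hyperplane_finite.toFinset.card : ℝ)

end CanonicalState

/-- Nearest neighbours: Manhattan distance `1`. -/
def Neighbour (x y : ℤ × ℤ) : Prop := |y.1 - x.1| + |y.2 - x.2| = 1

instance (x y : ℤ × ℤ) : Decidable (Neighbour x y) :=
  inferInstanceAs (Decidable (|y.1 - x.1| + |y.2 - x.2| = 1))

/-- The generator `L_n` of the symmetric simple exclusion process restricted to jumps with both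
extremities in `B_n`. -/
noncomputable def generator (n : ℕ) (g : Config (box n) → ℝ) (η : Config (box n)) : ℝ :=
  ∑ x : box n, ∑ y : box n,
    if Neighbour x.1 y.1 then
      (η x).eta * (1 - (η y).eta) * (g (η ∘ Equiv.swap x y) - g η)
    else 0

/-- The Dirichlet form `⟨g, -L_n g⟩` with respect to the canonical measure. -/
noncomputable def dirichletForm {n : ℕ} (K : CanonicalState n) (g : Config (box n) → ℝ) : ℝ :=
  K.expect (fun η => g η * -(generator n g η))

end APLG

namespace APLG

/-! Fix one configuration `ξ` of the hyperplane and regard the sites as labels. A permutation `τ`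
puts the content of label `i` at position `τ i`, and the canonical measure is the image of the
uniform measure on permutations. Left multiplication by a transposition exchanges the contents of
two positions; right multiplication exchanges two labels. With `P` the set of the labels of
particles, a function of `T^ω` becomes `∑ i ∈ P, m i i τ`, where `m i i` depends only on the
position of particle `i` and on the occupied set.

Decoupling: double centring of the matrix `m i k` splits the function into a function of the
occupied set and a sum of centred terms. Relabelling particles turns cross terms into diagonal ones,
so the squared norm of the centred sum is `#P / (#P - 1)` times the sum of the squared norms. The
increments along a given jump have the same structure. Hence variance and Dirichlet form both
decouple, up to a factor 2 (`IsKernel.sum_sq_add_bounds`, `IsKernel.jumpEnergy_add_le`), and a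
Poincaré inequality for functions of one tagged particle and the occupied set suffices
(`IsGridLike.tagged_poincare`).

Tagged particle: while the tag stays at `x`, exchanging two other neighbouring contents either has
no effect or is a jump. The Poincaré inequality of random transpositions, compared with such
exchanges along paths in the box without `x`, controls the fluctuation around the mean given the
tag. To see how this mean varies with `x`, one hole is followed: it is led around the tag to a
neighbouring site and exchanged with the tag. All holes carry the same energy, so a single one
carries at most the fraction `1 / #Pᶜ` of the total; since `#Pᶜ ≥ (1 - α') |B_n|`, this is where the
density bound enters. Path arguments cost `n ^ 4` in sums over pairs of sites, and division by the
number of sites leaves `n ^ 2`. -/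

open Finset Equiv

/-! ### Quasi-distances along a segment. -/

/-- A quasi-distance on `S`: symmetric, zero on the diagonal, with a relaxed triangle
inequality. -/
structure IsQuasiDist {V : Type*} (S : Set V) (s : V → V → ℝ) : Prop where
  nonneg : ∀ p q, 0 ≤ s p q
  symm : ∀ p ∈ S, ∀ q ∈ S, s p q = s q p
  self : ∀ p ∈ S, s p p = 0
  tri : ∀ p ∈ S, ∀ q ∈ S, ∀ r ∈ S, s p r ≤ s p q + 2 * s q r

theorem IsQuasiDist.comap {V W : Type*} {S : Set V} {s : V → V → ℝ} (hs : IsQuasiDist S s)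
    {T : Set W} (φ : W → V) (hφ : ∀ w ∈ T, φ w ∈ S) :
    IsQuasiDist T (fun p q => s (φ p) (φ q)) where
  nonneg _ _ := hs.nonneg _ _
  symm p hp q hq := hs.symm _ (hφ p hp) _ (hφ q hq)
  self p hp := hs.self _ (hφ p hp)
  tri p hp q hq r hr := hs.tri _ (hφ p hp) _ (hφ q hq) _ (hφ r hr)

/-- Adding one bond at a time at the far end puts the factor 2 on the new bond only, so the factors
do not multiply. -/
theorem IsQuasiDist.le_sum_Ico {m : ℤ} {S : Set ℤ} {t : ℤ → ℤ → ℝ} (ht : IsQuasiDist S t)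
    {a : ℤ} (hS : Set.Icc a m ⊆ S) (b : ℤ) (hab : a ≤ b) (hb : b ≤ m) :
    t a b ≤ 2 * ∑ k ∈ Ico a b, t k (k + 1) := by
  induction b, hab using Int.leInduction with
  | base => simp [ht.self a (hS ⟨le_rfl, hb⟩)]
  | succ b hab ih =>
    have h1 := ht.tri a (hS ⟨le_rfl, by omega⟩) b (hS ⟨hab, by omega⟩) (b + 1)
      (hS ⟨by omega, hb⟩)
    have h2 := ih (by omega)
    have h3 : Ico a (b + 1) = insert b (Ico a b) := by
      ext k; simp only [mem_Ico, mem_insert]; omega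
    rw [h3, sum_insert (by simp)]
    linarith

/-- Cauchy–Schwarz over the `2 * n` bonds of the segment, whence `8 * n = 2 ^ 2 * (2 * n)`. -/
theorem IsQuasiDist.sq_le_chain {n : ℕ} {t : ℤ → ℤ → ℝ}
    (ht : IsQuasiDist (Set.Icc (-(n : ℤ)) n) t) {a b : ℤ}
    (ha : a ∈ Set.Icc (-(n : ℤ)) n) (hb : b ∈ Set.Icc (-(n : ℤ)) n) :
    t a b ^ 2 ≤ 8 * n * ∑ k ∈ Ico (-(n : ℤ)) n, t k (k + 1) ^ 2 := by
  have key : t a b ≤ 2 * ∑ k ∈ Ico (-(n : ℤ)) n, t k (k + 1) := by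
    have main : ∀ a b : ℤ, a ∈ Set.Icc (-(n : ℤ)) n → b ∈ Set.Icc (-(n : ℤ)) n → a ≤ b →
        t a b ≤ 2 * ∑ k ∈ Ico (-(n : ℤ)) n, t k (k + 1) := by
      intro a b ha hb hab
      have h1 := ht.le_sum_Ico (m := n) (a := a) (Set.Icc_subset_Icc ha.1 le_rfl) b hab hb.2
      have h2 : ∑ k ∈ Ico a b, t k (k + 1) ≤ ∑ k ∈ Ico (-(n : ℤ)) n, t k (k + 1) :=
        sum_le_sum_of_subset_of_nonneg (Ico_subset_Ico ha.1 hb.2) fun _ _ _ => ht.nonneg _ _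
      linarith
    rcases le_total a b with h | h
    · exact main a b ha hb h
    · rw [ht.symm a ha b hb]; exact main b a hb ha h
  have h0 : (∑ k ∈ Ico (-(n : ℤ)) n, t k (k + 1)) ^ 2
      ≤ (#(Ico (-(n : ℤ)) n) : ℝ) * ∑ k ∈ Ico (-(n : ℤ)) n, t k (k + 1) ^ 2 :=
    sq_sum_le_card_mul_sum_sq
  have hc : (#(Ico (-(n : ℤ)) n) : ℝ) = 2 * n := by
    rw [Int.card_Ico]
    have : ((n : ℤ) - -(n : ℤ)).toNat = 2 * n := by omega
    rw [this]; push_cast; ring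
  rw [hc] at h0
  have := pow_le_pow_left₀ (ht.nonneg a b) key 2
  nlinarith

/-! ### Path inequalities in the full box. -/

theorem mem_box {n : ℕ} {x : ℤ × ℤ} :
    x ∈ box n ↔ (-(n : ℤ) ≤ x.1 ∧ x.1 ≤ n) ∧ (-(n : ℤ) ≤ x.2 ∧ x.2 ≤ n) := by
  simp only [box, Finset.mem_Icc, Prod.le_def]; tauto

theorem box_eq_product (n : ℕ) :
    box n = Finset.Icc (-(n : ℤ)) n ×ˢ Finset.Icc (-(n : ℤ)) n := by
  ext x; simp [mem_box]

theorem card_box (n : ℕ) : #(box n) = (2 * n + 1) ^ 2 := by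
  rw [box_eq_product, card_product, Int.card_Icc]
  have : ((n : ℤ) + 1 - -(n : ℤ)).toNat = 2 * n + 1 := by omega
  rw [this, sq]

/-- The point of the box with given coordinates (the centre, if they are out of range). -/
noncomputable def boxPt (n : ℕ) (a b : ℤ) : box n :=
  if h : (a, b) ∈ box n then ⟨(a, b), h⟩ else ⟨(0, 0), by simp [mem_box]⟩

theorem boxPt_val {n : ℕ} {a b : ℤ} (ha : a ∈ Set.Icc (-(n : ℤ)) n)
    (hb : b ∈ Set.Icc (-(n : ℤ)) n) : (boxPt n a b).1 = (a, b) := by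
  have h : (a, b) ∈ box n := mem_box.2 ⟨ha, hb⟩
  simp [boxPt, h]

theorem boxPt_coord {n : ℕ} (p : box n) : boxPt n p.1.1 p.1.2 = p := by
  simp [boxPt, p.2]

theorem fst_mem {n : ℕ} (p : box n) : p.1.1 ∈ Set.Icc (-(n : ℤ)) n := (mem_box.1 p.2).1

theorem snd_mem {n : ℕ} (p : box n) : p.1.2 ∈ Set.Icc (-(n : ℤ)) n := (mem_box.1 p.2).2

theorem sum_box {n : ℕ} (F : box n → ℝ) :
    ∑ p, F p = ∑ a ∈ Finset.Icc (-(n : ℤ)) n, ∑ b ∈ Finset.Icc (-(n : ℤ)) n, F (boxPt n a b) := by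
  rw [← sum_product' _ _ fun a b => F (boxPt n a b), ← box_eq_product,
    ← Finset.sum_coe_sort (box n) fun x => F (boxPt n x.1 x.2)]
  exact sum_congr rfl fun p _ => by rw [boxPt_coord]

theorem Neighbour.symm {x y : ℤ × ℤ} (h : Neighbour x y) : Neighbour y x := by
  unfold Neighbour at *
  rw [abs_sub_comm x.1, abs_sub_comm x.2]; exact h

theorem Neighbour.ne {x y : ℤ × ℤ} (h : Neighbour x y) : x ≠ y := by
  rintro rfl; simp [Neighbour] at h

open Classical in
/-- The sum of the squares of `s` over the oriented bonds of the relation `R` inside `S`. -/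
noncomputable def energy {V : Type*} [Fintype V] (R : V → V → Prop) (S : Set V)
    (s : V → V → ℝ) : ℝ :=
  ∑ p, ∑ q, if R p q ∧ p ∈ S ∧ q ∈ S then s p q ^ 2 else 0

section Energy

variable {V : Type*} [Fintype V] {R : V → V → Prop}

theorem energy_nonneg (S : Set V) (s : V → V → ℝ) : 0 ≤ energy R S s :=
  sum_nonneg fun _ _ => sum_nonneg fun _ _ => by split_ifs <;> positivity

theorem sq_le_energy {S : Set V} (s : V → V → ℝ) {p q : V}
    (h : R p q) (hp : p ∈ S) (hq : q ∈ S) : s p q ^ 2 ≤ energy R S s := by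
  classical
  have h1 : s p q ^ 2 = if R p q ∧ p ∈ S ∧ q ∈ S then s p q ^ 2 else 0 := by
    rw [if_pos ⟨h, hp, hq⟩]
  rw [h1]
  unfold energy
  refine (single_le_sum (f := fun q => if R p q ∧ p ∈ S ∧ q ∈ S then s p q ^ 2 else 0)
    (fun _ _ => by split_ifs <;> positivity) (mem_univ q)).trans ?_
  refine (single_le_sum
    (f := fun p => ∑ q, if R p q ∧ p ∈ S ∧ q ∈ S then s p q ^ 2 else 0)
    (fun _ _ => sum_nonneg fun _ _ => by split_ifs <;> positivity) (mem_univ p)).trans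
    (le_of_eq ?_)
  congr!

theorem energy_univ [DecidableRel R] (s : V → V → ℝ) :
    energy R Set.univ s = ∑ p, ∑ q, if R p q then s p q ^ 2 else 0 := by
  unfold energy
  simp only [Set.mem_univ, and_self, and_true]

theorem energy_compl [DecidableEq V] [DecidableRel R] (x : V) (s : V → V → ℝ) :
    energy R {x}ᶜ s = ∑ p, ∑ q, if R p q ∧ p ≠ x ∧ q ≠ x then s p q ^ 2 else 0 := by
  unfold energy
  simp only [Set.mem_compl_iff, Set.mem_singleton_iff, ← ne_eq]

end Energy

/-- The nearest-neighbour relation of the box. -/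
abbrev boxAdj (n : ℕ) (p q : box n) : Prop := Neighbour p.1 q.1

section Grid

variable {n : ℕ} (s : box n → box n → ℝ)

/-- The energy of the row of height `b`. -/
noncomputable def rowEnergy (b : ℤ) : ℝ :=
  ∑ k ∈ Ico (-(n : ℤ)) n, s (boxPt n k b) (boxPt n (k + 1) b) ^ 2

/-- The energy of the column of abscissa `a`. -/
noncomputable def colEnergy (a : ℤ) : ℝ :=
  ∑ k ∈ Ico (-(n : ℤ)) n, s (boxPt n a k) (boxPt n a (k + 1)) ^ 2

theorem rowEnergy_nonneg (b : ℤ) : 0 ≤ rowEnergy s b := sum_nonneg fun _ _ => sq_nonneg _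

theorem colEnergy_nonneg (a : ℤ) : 0 ≤ colEnergy s a := sum_nonneg fun _ _ => sq_nonneg _

theorem sum_rowEnergy_add_sum_colEnergy_le :
    ∑ b ∈ Finset.Icc (-(n : ℤ)) n, rowEnergy s b + ∑ a ∈ Finset.Icc (-(n : ℤ)) n, colEnergy s a
      ≤ energy (boxAdj n) Set.univ s := by
  classical
  let I := Finset.Icc (-(n : ℤ)) n
  let J := Ico (-(n : ℤ)) n
  let G : box n → box n → ℝ := fun p q => if Neighbour p.1 q.1 then s p q ^ 2 else 0
  have hG : ∀ p q, 0 ≤ G p q := fun p q => by simp only [G]; split_ifs <;> positivity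
  have hE : energy (boxAdj n) Set.univ s = ∑ p : box n, ∑ q : box n, G p q := by
    simp [energy_univ, G]
  have hpt : ∀ a ∈ I, ∀ b ∈ I, (boxPt n a b).1 = (a, b) := fun a ha b hb =>
    boxPt_val (by simpa [I] using ha) (by simpa [I] using hb)
  have hJ : ∀ k ∈ J, k ∈ I ∧ k + 1 ∈ I := by
    intro k hk; simp only [J, I, mem_Ico, Finset.mem_Icc] at *; omega
  rw [hE, sum_box]
  have hrow : ∑ b ∈ I, rowEnergy s b
      = ∑ a ∈ I, ∑ b ∈ I, if a ∈ J then G (boxPt n a b) (boxPt n (a + 1) b) else 0 := by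
    rw [sum_comm]
    refine sum_congr rfl fun b hb => ?_
    rw [← sum_filter, rowEnergy]
    have : I.filter (· ∈ J) = J := by
      ext k; simp only [mem_filter]; exact ⟨fun h => h.2, fun h => ⟨(hJ k h).1, h⟩⟩
    rw [this]
    refine sum_congr rfl fun k hk => ?_
    simp only [G]
    rw [if_pos]
    rw [hpt _ (hJ k hk).1 _ hb, hpt _ (hJ k hk).2 _ hb]
    simp [Neighbour]
  have hcol : ∑ a ∈ I, colEnergy s a
      = ∑ a ∈ I, ∑ b ∈ I, if b ∈ J then G (boxPt n a b) (boxPt n a (b + 1)) else 0 := by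
    refine sum_congr rfl fun a ha => ?_
    rw [← sum_filter, colEnergy]
    have : I.filter (· ∈ J) = J := by
      ext k; simp only [mem_filter]; exact ⟨fun h => h.2, fun h => ⟨(hJ k h).1, h⟩⟩
    rw [this]
    refine sum_congr rfl fun k hk => ?_
    simp only [G]
    rw [if_pos]
    rw [hpt _ ha _ (hJ k hk).1, hpt _ ha _ (hJ k hk).2]
    simp [Neighbour]
  rw [hrow, hcol, ← sum_add_distrib]
  refine sum_le_sum fun a ha => ?_
  rw [← sum_add_distrib]
  refine sum_le_sum fun b hb => ?_
  have h1 : ∑ q ∈ ({q | q = boxPt n (a + 1) b ∧ a ∈ J ∨ q = boxPt n a (b + 1) ∧ b ∈ J} :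
      Finset (box n)), G (boxPt n a b) q ≤ ∑ q, G (boxPt n a b) q :=
    sum_le_sum_of_subset_of_nonneg (subset_univ _) fun _ _ _ => hG _ _
  refine le_trans (le_of_eq ?_) h1
  by_cases hA : a ∈ J <;> by_cases hB : b ∈ J
  · have hne : boxPt n (a + 1) b ≠ boxPt n a (b + 1) := by
      intro h
      have := congrArg (fun p => p.1.1) h
      simp only [hpt _ (hJ a hA).2 _ hb, hpt _ ha _ (hJ b hB).2] at this
      omega
    have : ({q | q = boxPt n (a + 1) b ∧ a ∈ J ∨ q = boxPt n a (b + 1) ∧ b ∈ J} :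
        Finset (box n)) = {boxPt n (a + 1) b, boxPt n a (b + 1)} := by
      ext q; simp [hA, hB]
    rw [this, sum_pair hne]; simp [hA, hB]
  · simp [hA, hB, Finset.filter_eq']
  · simp [hA, hB, Finset.filter_eq']
  · simp [hA, hB]

variable {s}

/-- The path follows the row of `p`, then the column of `q`. Keeping only the energies of this row
and this column gains a factor of order `n` when summing over all pairs. -/
theorem IsQuasiDist.sq_le_row_add_col (hs : IsQuasiDist Set.univ s) (p q : box n) :
    s p q ^ 2 ≤ 64 * n * (rowEnergy s p.1.2 + colEnergy s q.1.1) := by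
  have hrow : s p (boxPt n q.1.1 p.1.2) ^ 2 ≤ 8 * n * rowEnergy s p.1.2 := by
    have ht : IsQuasiDist (Set.Icc (-(n : ℤ)) n)
        (fun a a' => s (boxPt n a p.1.2) (boxPt n a' p.1.2)) :=
      hs.comap (fun a => boxPt n a p.1.2) fun _ _ => Set.mem_univ _
    have := ht.sq_le_chain (fst_mem p) (fst_mem q)
    simpa only [boxPt_coord, rowEnergy] using this
  have hcol : s (boxPt n q.1.1 p.1.2) q ^ 2 ≤ 8 * n * colEnergy s q.1.1 := by
    have ht : IsQuasiDist (Set.Icc (-(n : ℤ)) n)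
        (fun b b' => s (boxPt n q.1.1 b) (boxPt n q.1.1 b')) :=
      hs.comap (fun b => boxPt n q.1.1 b) fun _ _ => Set.mem_univ _
    have := ht.sq_le_chain (snd_mem p) (snd_mem q)
    simpa only [boxPt_coord, colEnergy] using this
  have h1 := hs.tri p trivial (boxPt n q.1.1 p.1.2) trivial q trivial
  have h2 := pow_le_pow_left₀ (hs.nonneg p q) h1 2
  have h3 := rowEnergy_nonneg s p.1.2
  have hn : (0 : ℝ) ≤ n * rowEnergy s p.1.2 := by positivity
  nlinarith [sq_nonneg (s p (boxPt n q.1.1 p.1.2) - 2 * s (boxPt n q.1.1 p.1.2) q)]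

theorem IsQuasiDist.sq_le_energy (hs : IsQuasiDist Set.univ s) (p q : box n) :
    s p q ^ 2 ≤ 64 * n * energy (boxAdj n) Set.univ s := by
  refine (hs.sq_le_row_add_col p q).trans ?_
  gcongr
  refine le_trans (add_le_add ?_ ?_) (sum_rowEnergy_add_sum_colEnergy_le s)
  · exact single_le_sum (f := rowEnergy s) (fun _ _ => rowEnergy_nonneg s _)
      (Finset.mem_Icc.2 (snd_mem p))
  · exact single_le_sum (f := colEnergy s) (fun _ _ => colEnergy_nonneg s _)
      (Finset.mem_Icc.2 (fst_mem q))

theorem IsQuasiDist.sum_sq_le_energy (hs : IsQuasiDist Set.univ s) :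
    ∑ p, ∑ q, s p q ^ 2 ≤ 1728 * (n : ℝ) ^ 4 * energy (boxAdj n) Set.univ s := by
  rcases Nat.eq_zero_or_pos n with rfl | hn
  · have : ∀ p q : box 0, s p q ^ 2 ≤ 0 := fun p q => by
      simpa using hs.sq_le_energy p q
    simpa using sum_nonpos fun p (_ : p ∈ univ) => sum_nonpos fun q (_ : q ∈ univ) => this p q
  have hcard : (#(Finset.Icc (-(n : ℤ)) n) : ℝ) = 2 * n + 1 := by
    rw [Int.card_Icc]
    have : ((n : ℤ) + 1 - -(n : ℤ)).toNat = 2 * n + 1 := by omega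
    rw [this]; push_cast; ring
  have hR : ∀ p : box n, ∑ q : box n, s p q ^ 2 ≤ 64 * n * ((2 * n + 1) ^ 2 * rowEnergy s p.1.2
      + (2 * n + 1) * ∑ a ∈ Finset.Icc (-(n : ℤ)) n, colEnergy s a) := by
    intro p
    refine (sum_le_sum fun q _ => hs.sq_le_row_add_col p q).trans (le_of_eq ?_)
    rw [← mul_sum, sum_add_distrib, sum_const, card_univ, Fintype.card_coe, card_box, sum_box]
    congr 2
    · simp
    · rw [mul_sum]
      refine sum_congr rfl fun a ha => ?_
      rw [← hcard, ← nsmul_eq_mul, ← sum_const]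
      refine sum_congr rfl fun b hb => ?_
      rw [boxPt_val (by simpa using ha) (by simpa using hb)]
  have hsum : ∑ p : box n, rowEnergy s p.1.2
      = (2 * n + 1) * ∑ b ∈ Finset.Icc (-(n : ℤ)) n, rowEnergy s b := by
    rw [sum_box, ← hcard, ← nsmul_eq_mul, ← sum_const]
    refine sum_congr rfl fun a ha => sum_congr rfl fun b hb => ?_
    rw [boxPt_val (by simpa using ha) (by simpa using hb)]
  have hE := sum_rowEnergy_add_sum_colEnergy_le s
  have hn1 : (1 : ℝ) ≤ n := by exact_mod_cast hn
  calc ∑ p, ∑ q, s p q ^ 2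
      ≤ ∑ p : box n, 64 * n * ((2 * n + 1) ^ 2 * rowEnergy s p.1.2
        + (2 * n + 1) * ∑ a ∈ Finset.Icc (-(n : ℤ)) n, colEnergy s a) :=
        sum_le_sum fun p _ => hR p
    _ = 64 * n * (2 * n + 1) ^ 3 * (∑ b ∈ Finset.Icc (-(n : ℤ)) n, rowEnergy s b
        + ∑ a ∈ Finset.Icc (-(n : ℤ)) n, colEnergy s a) := by
        rw [← mul_sum, sum_add_distrib, ← mul_sum, hsum, sum_const, card_univ, Fintype.card_coe,
          card_box]
        simp only [nsmul_eq_mul]; push_cast; ring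
    _ ≤ 64 * n * (3 * n) ^ 3 * energy (boxAdj n) Set.univ s := by
        gcongr
        · exact add_nonneg (sum_nonneg fun _ _ => rowEnergy_nonneg s _)
            (sum_nonneg fun _ _ => colEnergy_nonneg s _)
        · linarith
    _ = 1728 * (n : ℝ) ^ 4 * energy (boxAdj n) Set.univ s := by ring

end Grid

/-! ### Path inequalities in the box with one site removed. -/

/-- Two neighbours of `x` are joined by a short path which avoids `x`. -/
theorem IsQuasiDist.sq_le_energy_detour {n : ℕ} (hn : 1 ≤ n) {x : box n} {s : box n → box n → ℝ}
    (hs : IsQuasiDist {x}ᶜ s) {w w' : box n} (hw : Neighbour x.1 w.1) (hw' : Neighbour x.1 w'.1) :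
    s w w' ^ 2 ≤ 324 * energy (boxAdj n) {x}ᶜ s := by
  have hE := energy_nonneg (R := boxAdj n) {x}ᶜ s
  set e := √(energy (boxAdj n) {x}ᶜ s) with he
  have he0 : 0 ≤ e := Real.sqrt_nonneg _
  have he2 : e ^ 2 = energy (boxAdj n) {x}ᶜ s := Real.sq_sqrt hE
  have edge : ∀ p q : box n, Neighbour p.1 q.1 → p ≠ x → q ≠ x → s p q ≤ e := fun p q h hp hq =>
    Real.le_sqrt_of_sq_le (APLG.sq_le_energy (R := boxAdj n) s h hp hq)
  obtain ⟨⟨x1, x2⟩, hx⟩ := x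
  have hx' := mem_box.1 hx
  simp only at hx'
  -- The signs `d1`, `d2` point into the box, so that the corner `x + (d1, d2)` belongs to it and
  -- serves as a hub for all neighbours of `x`.
  obtain ⟨d1, hd1, hd1'⟩ : ∃ d : ℤ, (d = 1 ∨ d = -1) ∧ -(n : ℤ) ≤ x1 + d ∧ x1 + d ≤ n := by
    by_cases h : x1 + 1 ≤ n
    · exact ⟨1, Or.inl rfl, by omega, h⟩
    · exact ⟨-1, Or.inr rfl, by omega, by omega⟩
  obtain ⟨d2, hd2, hd2'⟩ : ∃ d : ℤ, (d = 1 ∨ d = -1) ∧ -(n : ℤ) ≤ x2 + d ∧ x2 + d ≤ n := by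
    by_cases h : x2 + 1 ≤ n
    · exact ⟨1, Or.inl rfl, by omega, h⟩
    · exact ⟨-1, Or.inr rfl, by omega, by omega⟩
  have hc : (x1 + d1, x2 + d2) ∈ box n := mem_box.2 ⟨hd1', hd2'⟩
  -- At most three bonds around `x` reach the hub, at cost at most `e + 2 * e + 2 * e ≤ 6 * e`. Two
  -- neighbours joined through the hub then cost `6 * e + 2 * (6 * e) = 18 * e`, and `324 = 18 ^ 2`.
  have key : ∀ w : box n, Neighbour (x1, x2) w.1 → s w ⟨(x1 + d1, x2 + d2), hc⟩ ≤ 6 * e := by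
    rintro ⟨⟨a, b⟩, hab⟩ h
    have hab' := mem_box.1 hab
    simp only [Neighbour] at h hab'
    have hcases : (a = x1 + d1 ∧ b = x2) ∨ (a = x1 - d1 ∧ b = x2) ∨ (a = x1 ∧ b = x2 + d2) ∨
        (a = x1 ∧ b = x2 - d2) := by
      rcases abs_cases (a - x1) with ⟨h1, h2⟩ | ⟨h1, h2⟩ <;>
      rcases abs_cases (b - x2) with ⟨h3, h4⟩ | ⟨h3, h4⟩ <;> omega
    have h1 : (x1 + d1, x2) ∈ box n := mem_box.2 ⟨hd1', hx'.2⟩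
    have h2 : (x1, x2 + d2) ∈ box n := mem_box.2 ⟨hx'.1, hd2'⟩
    have nb : ∀ p q p' q' : ℤ, (|p' - p| + |q' - q| = 1) → Neighbour (p, q) (p', q') :=
      fun _ _ _ _ h => h
    have ad1 : |d1| = 1 := by rcases hd1 with rfl | rfl <;> simp
    have ad2 : |d2| = 1 := by rcases hd2 with rfl | rfl <;> simp
    rcases hcases with ⟨rfl, rfl⟩ | ⟨rfl, rfl⟩ | ⟨rfl, rfl⟩ | ⟨rfl, rfl⟩
    · refine (edge _ _ (nb _ _ _ _ (by simp [ad2])) ?_ ?_).trans (by linarith) <;>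
        (simp; try omega)
    · have h3 : (x1 - d1, b + d2) ∈ box n := mem_box.2 ⟨hab'.1, hd2'⟩
      have e1 := edge ⟨(x1 - d1, b), hab⟩ ⟨(x1 - d1, b + d2), h3⟩
        (nb _ _ _ _ (by simp [ad2])) (by simp; omega) (by simp; omega)
      have e2 := edge ⟨(x1 - d1, b + d2), h3⟩ ⟨(x1, b + d2), h2⟩
        (nb _ _ _ _ (by simp [ad1])) (by simp; omega) (by simp; omega)
      have e3 := edge ⟨(x1, b + d2), h2⟩ ⟨(x1 + d1, b + d2), hc⟩
        (nb _ _ _ _ (by simp [ad1])) (by simp; omega) (by simp; omega)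
      have t1 := hs.tri ⟨(x1 - d1, b), hab⟩ (by simp; omega) ⟨(x1 - d1, b + d2), h3⟩
        (by simp; omega) ⟨(x1, b + d2), h2⟩ (by simp; omega)
      have t2 := hs.tri ⟨(x1 - d1, b), hab⟩ (by simp; omega) ⟨(x1, b + d2), h2⟩
        (by simp; omega) ⟨(x1 + d1, b + d2), hc⟩ (by simp; omega)
      linarith
    · refine (edge _ _ (nb _ _ _ _ (by simp [ad1])) ?_ ?_).trans (by linarith) <;>
        (simp; try omega)
    · have h3 : (a + d1, x2 - d2) ∈ box n := mem_box.2 ⟨hd1', hab'.2⟩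
      have e1 := edge ⟨(a, x2 - d2), hab⟩ ⟨(a + d1, x2 - d2), h3⟩
        (nb _ _ _ _ (by simp [ad1])) (by simp; omega) (by simp; omega)
      have e2 := edge ⟨(a + d1, x2 - d2), h3⟩ ⟨(a + d1, x2), h1⟩
        (nb _ _ _ _ (by simp [ad2])) (by simp; omega) (by simp; omega)
      have e3 := edge ⟨(a + d1, x2), h1⟩ ⟨(a + d1, x2 + d2), hc⟩
        (nb _ _ _ _ (by simp [ad2])) (by simp; omega) (by simp; omega)
      have t1 := hs.tri ⟨(a, x2 - d2), hab⟩ (by simp; omega) ⟨(a + d1, x2 - d2), h3⟩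
        (by simp; omega) ⟨(a + d1, x2), h1⟩ (by simp; omega)
      have t2 := hs.tri ⟨(a, x2 - d2), hab⟩ (by simp; omega) ⟨(a + d1, x2), h1⟩
        (by simp; omega) ⟨(a + d1, x2 + d2), hc⟩ (by simp; omega)
      linarith
  have hne : ∀ w : box n, Neighbour (x1, x2) w.1 → w ∈ ({⟨(x1, x2), hx⟩}ᶜ : Set (box n)) := by
    rintro w h rfl; exact h.ne rfl
  have hcne : (⟨(x1 + d1, x2 + d2), hc⟩ : box n) ∈ ({⟨(x1, x2), hx⟩}ᶜ : Set (box n)) := by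
    simp; omega
  have h1 := key w hw
  have h2 := key w' hw'
  rw [hs.symm _ (hne _ hw') _ hcne] at h2
  have h3 := hs.tri w (hne _ hw) _ hcne w' (hne _ hw')
  have h4 : s w w' ≤ 18 * e := by linarith
  have := pow_le_pow_left₀ (hs.nonneg w w') h4 2
  nlinarith

theorem exists_neighbour {n : ℕ} (hn : 1 ≤ n) (x : box n) : ∃ y : box n, Neighbour x.1 y.1 := by
  obtain ⟨⟨x1, x2⟩, hx⟩ := x
  have hx' := mem_box.1 hx
  simp only at hx'
  by_cases h : x1 + 1 ≤ n
  · exact ⟨⟨(x1 + 1, x2), mem_box.2 ⟨⟨by simp; omega, h⟩, hx'.2⟩⟩, by simp [Neighbour]⟩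
  · exact ⟨⟨(x1 - 1, x2), mem_box.2 ⟨⟨by simp; omega, by simp; omega⟩, hx'.2⟩⟩,
      by simp [Neighbour]⟩

theorem card_neighbours_le {n : ℕ} (x : box n) : #{q : box n | Neighbour x.1 q.1} ≤ 4 := by
  classical
  rw [← card_map (Function.Embedding.subtype _)]
  refine (card_le_card (t := {(x.1.1 + 1, x.1.2), (x.1.1 - 1, x.1.2), (x.1.1, x.1.2 + 1),
    (x.1.1, x.1.2 - 1)}) ?_).trans card_le_four
  intro y hy
  simp only [mem_map, mem_filter, mem_univ, true_and, Function.Embedding.subtype_apply] at hy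
  obtain ⟨q, hq, rfl⟩ := hy
  simp only [Neighbour] at hq
  simp only [mem_insert, mem_singleton, Prod.ext_iff]
  rcases abs_cases (q.1.1 - x.1.1) with ⟨h1, h2⟩ | ⟨h1, h2⟩ <;>
  rcases abs_cases (q.1.2 - x.1.2) with ⟨h3, h4⟩ | ⟨h3, h4⟩ <;> omega

-- The missing site is retracted onto its neighbour `x'`. Bonds away from `x` are unchanged; the at
-- most eight oriented bonds at `x` become pairs of neighbours of `x`, bounded by the detour: `2593
-- = 1 + 2 * 4 * 324`.
open Classical in
theorem IsQuasiDist.energy_comap_le {n : ℕ} (hn : 1 ≤ n) {x x' : box n} {s : box n → box n → ℝ}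
    (hs : IsQuasiDist {x}ᶜ s) (hx' : Neighbour x.1 x'.1) :
    energy (boxAdj n) Set.univ (fun p q => s (Function.update id x x' p) (Function.update id x x' q))
      ≤ 2593 * energy (boxAdj n) {x}ᶜ s := by
  have hE := energy_nonneg (R := boxAdj n) {x}ᶜ s
  let ρ : box n → box n := Function.update id x x'
  have hx : ρ x = x' := by simp [ρ]
  have hρ : ∀ p, p ≠ x → ρ p = p := fun p hp => by simp [ρ, hp]
  have hterm : ∀ p q : box n,
      (if Neighbour p.1 q.1 then s (ρ p) (ρ q) ^ 2 else 0) ≤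
      (if Neighbour p.1 q.1 ∧ p ≠ x ∧ q ≠ x then s p q ^ 2 else 0)
      + (if p = x then if Neighbour x.1 q.1 then 324 * energy (boxAdj n) {x}ᶜ s else 0 else 0)
      + (if q = x then if Neighbour x.1 p.1 then 324 * energy (boxAdj n) {x}ᶜ s else 0 else 0) := by
    intro p q
    by_cases hpq : Neighbour p.1 q.1
    · by_cases hp : p = x
      · subst hp
        have hq : q ≠ p := fun h => hpq.ne (by rw [h])
        have := hs.sq_le_energy_detour hn hx' hpq
        simp [hpq, hq, hx, hρ q hq, this]
      · by_cases hq : q = x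
        · subst hq
          have := hs.sq_le_energy_detour hn hpq.symm hx'
          simp [hpq, hp, hx, hρ p hp, hpq.symm, this]
        · simp [hpq, hp, hq, hρ p hp, hρ q hq]
    · have h1 : 0 ≤ (if p = x then if Neighbour x.1 q.1 then 324 * energy (boxAdj n) {x}ᶜ s else 0 else 0) := by
        split_ifs <;> positivity
      have h2 : 0 ≤ (if q = x then if Neighbour x.1 p.1 then 324 * energy (boxAdj n) {x}ᶜ s else 0 else 0) := by
        split_ifs <;> positivity
      simp only [hpq, false_and, if_false]
      linarith
  have hN : ∑ q : box n, (if Neighbour x.1 q.1 then 324 * energy (boxAdj n) {x}ᶜ s else 0)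
      ≤ 1296 * energy (boxAdj n) {x}ᶜ s := by
    rw [← sum_filter, sum_const, nsmul_eq_mul]
    have : (#{q : box n | Neighbour x.1 q.1} : ℝ) ≤ 4 := by exact_mod_cast card_neighbours_le x
    nlinarith
  calc energy (boxAdj n) Set.univ (fun p q => s (ρ p) (ρ q))
      ≤ ∑ p : box n, ∑ q : box n, ((if Neighbour p.1 q.1 ∧ p ≠ x ∧ q ≠ x then s p q ^ 2 else 0)
      + (if p = x then if Neighbour x.1 q.1 then 324 * energy (boxAdj n) {x}ᶜ s else 0 else 0)
      + (if q = x then if Neighbour x.1 p.1 then 324 * energy (boxAdj n) {x}ᶜ s else 0 else 0)) := by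
        rw [energy_univ]
        exact sum_le_sum fun p _ => sum_le_sum fun q _ => hterm p q
    _ = energy (boxAdj n) {x}ᶜ s + ∑ q : box n, (if Neighbour x.1 q.1 then 324 * energy (boxAdj n) {x}ᶜ s else 0)
        + ∑ q : box n, (if Neighbour x.1 q.1 then 324 * energy (boxAdj n) {x}ᶜ s else 0) := by
        simp only [sum_add_distrib]
        rw [← energy_compl]
        congr 1
        · congr 1
          rw [sum_comm]
          simp
        · simp
    _ ≤ _ := by linarith

open Classical in
theorem IsQuasiDist.comap_update {n : ℕ} {x x' : box n} {s : box n → box n → ℝ}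
    (hs : IsQuasiDist {x}ᶜ s) (hx' : Neighbour x.1 x'.1) : IsQuasiDist Set.univ
      (fun p q => s (Function.update id x x' p) (Function.update id x x' q)) := by
  refine hs.comap _ fun w _ => ?_
  by_cases h : w = x
  · subst h
    simp only [Function.update_self, Set.mem_compl_iff, Set.mem_singleton_iff]
    exact fun h => hx'.ne (by rw [h])
  · simp [h]

theorem IsQuasiDist.sq_le_energy_compl {n : ℕ} (hn : 1 ≤ n) {x : box n}
    {s : box n → box n → ℝ} (hs : IsQuasiDist {x}ᶜ s) {p q : box n} (hp : p ≠ x) (hq : q ≠ x) :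
    s p q ^ 2 ≤ 165952 * n * energy (boxAdj n) {x}ᶜ s := by
  classical
  -- The retracted quasi-distance lives on the full box and agrees with `s` away from `x`; `165952 =
  -- 64 * 2593`.
  obtain ⟨x', hx'⟩ := exists_neighbour hn x
  have h1 := (hs.comap_update hx').sq_le_energy p q
  simp only [Function.update_of_ne hp, Function.update_of_ne hq, id] at h1
  have h2 := hs.energy_comap_le hn hx'
  have : (0 : ℝ) ≤ 64 * n := by positivity
  nlinarith [mul_le_mul_of_nonneg_left h2 this]

open Classical in
theorem IsQuasiDist.sum_sq_le_energy_compl {n : ℕ} (hn : 1 ≤ n) {x : box n}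
    {s : box n → box n → ℝ} (hs : IsQuasiDist {x}ᶜ s) :
    ∑ p, ∑ q, (if p ≠ x ∧ q ≠ x then s p q ^ 2 else 0)
      ≤ 4480704 * (n : ℝ) ^ 4 * energy (boxAdj n) {x}ᶜ s := by
  obtain ⟨x', hx'⟩ := exists_neighbour hn x
  have h1 := (hs.comap_update hx').sum_sq_le_energy
  have h2 := hs.energy_comap_le hn hx'
  refine le_trans (sum_le_sum fun p _ => sum_le_sum fun q _ => ?_)
    (h1.trans ((mul_le_mul_of_nonneg_left h2 (by positivity)).trans (le_of_eq (by ring))))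
  split_ifs with h
  · simp [Function.update_of_ne h.1, Function.update_of_ne h.2]
  · positivity

/-! ### Random transpositions. -/

section Permutations

variable {V : Type*} [Fintype V] [DecidableEq V]

theorem sq_sum_div_card_le {ι : Type*} (s : Finset ι) (f : ι → ℝ) :
    ((∑ i ∈ s, f i) / #s) ^ 2 ≤ (∑ i ∈ s, f i ^ 2) / #s := by
  rcases s.eq_empty_or_nonempty with rfl | hs
  · simp
  have h : (0 : ℝ) < #s := by exact_mod_cast hs.card_pos
  have := sq_sum_le_card_mul_sum_sq (s := s) (f := f)
  rw [div_pow, div_le_div_iff₀ (by positivity) h]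
  nlinarith

/-- The permutations which move no point outside `S`. -/
def permsOn (S : Finset V) : Finset (Perm V) := {ρ | ∀ i, i ∉ S → ρ i = i}

theorem mem_permsOn {S : Finset V} {ρ : Perm V} : ρ ∈ permsOn S ↔ ∀ i, i ∉ S → ρ i = i := by
  simp [permsOn]

theorem one_mem_permsOn (S : Finset V) : (1 : Perm V) ∈ permsOn S := mem_permsOn.2 fun _ _ => rfl

theorem mul_mem_permsOn {S : Finset V} {ρ σ : Perm V} (hρ : ρ ∈ permsOn S) (hσ : σ ∈ permsOn S) :
    ρ * σ ∈ permsOn S :=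
  mem_permsOn.2 fun i hi => by
    rw [Perm.mul_apply, mem_permsOn.1 hσ i hi, mem_permsOn.1 hρ i hi]

theorem inv_mem_permsOn {S : Finset V} {ρ : Perm V} (hρ : ρ ∈ permsOn S) : ρ⁻¹ ∈ permsOn S :=
  mem_permsOn.2 fun i hi => by
    rw [Perm.inv_eq_iff_eq, mem_permsOn.1 hρ i hi]

theorem card_permsOn_pos (S : Finset V) : (0 : ℝ) < #(permsOn S) := by
  exact_mod_cast card_pos.2 ⟨1, one_mem_permsOn S⟩

theorem apply_mem_of_mem_permsOn {S : Finset V} {ρ : Perm V} (hρ : ρ ∈ permsOn S) {i : V}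
    (hi : i ∈ S) : ρ i ∈ S := by
  by_contra h
  exact h ((ρ.injective (mem_permsOn.1 hρ _ h)).symm ▸ hi)

/-- Coset decomposition: `ρ` is determined by `v = ρ u` and by `swap u v * ρ`, which fixes `u`. -/
theorem sum_permsOn_insert {S : Finset V} {u : V} (hu : u ∉ S) (F : Perm V → ℝ) :
    ∑ ρ ∈ permsOn (insert u S), F ρ
      = ∑ v ∈ insert u S, ∑ ρ ∈ permsOn S, F (swap u v * ρ) := by
  rw [← sum_product']
  symm
  refine sum_nbij' (fun p => swap u p.1 * p.2) (fun ρ => (ρ u, swap u (ρ u) * ρ)) ?_ ?_ ?_ ?_ ?_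
  · rintro ⟨v, ρ⟩ h
    rw [mem_product] at h
    refine mem_permsOn.2 fun i hi => ?_
    have h1 : i ∉ S := fun h => hi (mem_insert_of_mem h)
    rw [Perm.mul_apply, mem_permsOn.1 h.2 i h1]
    exact swap_apply_of_ne_of_ne (fun h => hi (h ▸ mem_insert_self _ _)) fun h' => hi (h' ▸ h.1)
  · intro ρ hρ
    have hv : ρ u ∈ insert u S := apply_mem_of_mem_permsOn hρ (mem_insert_self _ _)
    refine mem_product.2 ⟨hv, mem_permsOn.2 fun i hi => ?_⟩
    by_cases hiu : i = u
    · subst hiu; simp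
    · have hi' : i ∉ insert u S := by simp [hi, hiu]
      simp only [Perm.mul_apply]
      rw [mem_permsOn.1 hρ i hi']
      exact swap_apply_of_ne_of_ne hiu fun h' => hi' (h' ▸ hv)
  · rintro ⟨v, ρ⟩ h
    rw [mem_product] at h
    have : ρ u = u := mem_permsOn.1 h.2 u hu
    simp [this]
  · intro ρ _
    simp
  · intro p _
    rfl

theorem card_permsOn_insert {S : Finset V} {u : V} (hu : u ∉ S) :
    (#(permsOn (insert u S)) : ℝ) = (#S + 1) * #(permsOn S) := by
  have := sum_permsOn_insert hu fun _ => 1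
  simp only [sum_const, nsmul_eq_mul, mul_one, card_insert_of_notMem hu] at this
  rw [this]; push_cast; ring

/-- The average of `f` over the permutations of the labels in `S`. -/
noncomputable def permAvg (S : Finset V) (f : Perm V → ℝ) (τ : Perm V) : ℝ :=
  (∑ ρ ∈ permsOn S, f (τ * ρ)) / #(permsOn S)

theorem permAvg_insert {S : Finset V} {u : V} (hu : u ∉ S) (f : Perm V → ℝ) (τ : Perm V) :
    permAvg (insert u S) f τ
      = (∑ v ∈ insert u S, permAvg S f (τ * swap u v)) / #(insert u S) := by
  unfold permAvg
  rw [sum_permsOn_insert hu, card_permsOn_insert hu, ← sum_div, div_div,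
    card_insert_of_notMem hu]
  push_cast
  simp only [mul_assoc]
  rw [mul_comm ((#S : ℝ) + 1)]

theorem permAvg_mul {S : Finset V} {σ : Perm V} (hσ : σ ∈ permsOn S) (f : Perm V → ℝ)
    (τ : Perm V) : permAvg S f (τ * σ) = permAvg S f τ := by
  unfold permAvg
  congr 1
  refine sum_nbij' (fun ρ => σ * ρ) (fun ρ => σ⁻¹ * ρ) ?_ ?_ ?_ ?_ ?_
  · exact fun ρ hρ => mul_mem_permsOn hσ hρ
  · exact fun ρ hρ => mul_mem_permsOn (inv_mem_permsOn hσ) hρ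
  · exact fun ρ _ => by simp
  · exact fun ρ _ => by simp
  · exact fun ρ _ => by rw [mul_assoc]

theorem permsOn_mono {S T : Finset V} (h : S ⊆ T) : permsOn S ⊆ permsOn T := fun _ hρ =>
  mem_permsOn.2 fun i hi => mem_permsOn.1 hρ i fun h' => hi (h h')

/-- `permAvg S` is the conditional expectation onto the functions invariant under relabelling in
`S`. -/
theorem sum_permAvg_mul {S : Finset V} (f k : Perm V → ℝ)
    (hk : ∀ σ ∈ permsOn S, ∀ τ, k (τ * σ) = k τ) :
    ∑ τ, permAvg S f τ * k τ = ∑ τ, f τ * k τ := by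
  have hpos := card_permsOn_pos S
  have h : ∀ ρ ∈ permsOn S, ∑ τ, f (τ * ρ) * k τ = ∑ τ, f τ * k τ := by
    intro ρ hρ
    rw [← Equiv.sum_comp (Equiv.mulRight ρ) fun τ => f τ * k τ]
    refine sum_congr rfl fun τ _ => ?_
    simp only [Equiv.coe_mulRight, hk ρ hρ]
  simp only [permAvg, div_mul_eq_mul_div, sum_mul]
  rw [← sum_div, sum_comm, sum_congr rfl h, sum_const, nsmul_eq_mul]
  field_simp

/-- The sum of the squares of the increments of `f` along the exchange of the labels `u`, `v`. -/
noncomputable def swapEnergy (f : Perm V → ℝ) (u v : V) : ℝ :=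
  ∑ τ, (f (τ * swap u v) - f τ) ^ 2

theorem swapEnergy_nonneg (f : Perm V → ℝ) (u v : V) : 0 ≤ swapEnergy f u v :=
  sum_nonneg fun _ _ => sq_nonneg _

/-- As `ρ` fixes `u`, `swap u v * ρ = ρ * swap u (ρ⁻¹ v)`. Jensen bounds the increment of the
average by averaged increments of `f`, and `ρ` merely permutes the `v ∈ S`, which is why the sum
over `v` is taken. -/
theorem sum_swapEnergy_permAvg_le {S : Finset V} {u : V} (hu : u ∉ S) (f : Perm V → ℝ) :
    ∑ v ∈ S, swapEnergy (permAvg S f) u v ≤ ∑ v ∈ S, swapEnergy f u v := by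
  have hpos := card_permsOn_pos S
  have hdiff : ∀ v ∈ S, ∀ τ : Perm V, (permAvg S f (τ * swap u v) - permAvg S f τ) ^ 2
      ≤ (∑ ρ ∈ permsOn S, (f (τ * ρ * swap u (ρ⁻¹ v)) - f (τ * ρ)) ^ 2) / #(permsOn S) := by
    intro v _ τ
    have : permAvg S f (τ * swap u v) - permAvg S f τ
        = (∑ ρ ∈ permsOn S, (f (τ * ρ * swap u (ρ⁻¹ v)) - f (τ * ρ))) / #(permsOn S) := by
      simp only [permAvg]
      rw [← sub_div, ← sum_sub_distrib]
      congr 1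
      refine sum_congr rfl fun ρ hρ => ?_
      have hρu : ρ⁻¹ u = u := mem_permsOn.1 (inv_mem_permsOn hρ) u hu
      have h2 : swap u v * ρ = ρ * swap u (ρ⁻¹ v) := by
        rw [swap_mul_eq_mul_swap, hρu]
      rw [mul_assoc, h2, mul_assoc τ ρ]
    rw [this]
    exact sq_sum_div_card_le _ _
  calc ∑ v ∈ S, swapEnergy (permAvg S f) u v
      ≤ ∑ v ∈ S, ∑ τ : Perm V, (∑ ρ ∈ permsOn S,
          (f (τ * ρ * swap u (ρ⁻¹ v)) - f (τ * ρ)) ^ 2) / #(permsOn S) :=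
        sum_le_sum fun v hv => sum_le_sum fun τ _ => hdiff v hv τ
    _ = (∑ ρ ∈ permsOn S, ∑ v ∈ S, swapEnergy f u (ρ⁻¹ v)) / #(permsOn S) := by
        simp only [← sum_div]
        congr 1
        rw [sum_comm (s := permsOn S)]
        refine sum_congr rfl fun v _ => ?_
        rw [sum_comm]
        refine sum_congr rfl fun ρ _ => ?_
        exact Equiv.sum_comp (Equiv.mulRight ρ) fun τ => (f (τ * swap u (ρ⁻¹ v)) - f τ) ^ 2
    _ = (∑ ρ ∈ permsOn S, ∑ v ∈ S, swapEnergy f u v) / #(permsOn S) := by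
        congr 1
        refine sum_congr rfl fun ρ hρ => ?_
        refine sum_nbij' (fun v => ρ⁻¹ v) (fun v => ρ v) ?_ ?_ ?_ ?_ ?_
        · exact fun v hv => apply_mem_of_mem_permsOn (inv_mem_permsOn hρ) hv
        · exact fun v hv => apply_mem_of_mem_permsOn hρ hv
        · exact fun v _ => by simp
        · exact fun v _ => by simp
        · exact fun v _ => rfl
    _ = ∑ v ∈ S, swapEnergy f u v := by
        rw [sum_const, nsmul_eq_mul]; field_simp

/-- Pythagoras for nested conditional expectations. The new term is the difference between `permAvg
S f` and its average over the `swap u v`, bounded by Jensen and the contraction of energy. -/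
theorem sum_sq_sub_permAvg_insert_le {S : Finset V} {u : V} (hu : u ∉ S) (f : Perm V → ℝ) :
    ∑ τ, (f τ - permAvg (insert u S) f τ) ^ 2
      ≤ ∑ τ, (f τ - permAvg S f τ) ^ 2 + (∑ v ∈ S, swapEnergy f u v) / #(insert u S) := by
  have hcard : (0 : ℝ) < #(insert u S) := by
    exact_mod_cast card_pos.2 ⟨u, mem_insert_self _ _⟩
  set F := permAvg S f with hF
  set G := permAvg (insert u S) f with hG
  have hinv : ∀ σ ∈ permsOn S, ∀ τ, (F (τ * σ) - G (τ * σ)) = F τ - G τ := by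
    intro σ hσ τ
    rw [hF, hG, permAvg_mul hσ, permAvg_mul (permsOn_mono (subset_insert _ _) hσ)]
  have hcross : ∑ τ, F τ * (F τ - G τ) = ∑ τ, f τ * (F τ - G τ) :=
    sum_permAvg_mul f (fun τ => F τ - G τ) hinv
  have hpyth : ∑ τ, (f τ - G τ) ^ 2 = ∑ τ, (f τ - F τ) ^ 2 + ∑ τ, (F τ - G τ) ^ 2 := by
    have : ∑ τ, (f τ - G τ) ^ 2 = ∑ τ, ((f τ - F τ) ^ 2 + (F τ - G τ) ^ 2
        + 2 * (f τ * (F τ - G τ) - F τ * (F τ - G τ))) :=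
      sum_congr rfl fun τ _ => by ring
    rw [this, sum_add_distrib, sum_add_distrib, ← mul_sum, sum_sub_distrib, hcross]
    ring
  rw [hpyth]
  gcongr
  have hpt : ∀ τ, (F τ - G τ) ^ 2 ≤ (∑ v ∈ insert u S, (F (τ * swap u v) - F τ) ^ 2)
      / #(insert u S) := by
    intro τ
    have : F τ - G τ = -((∑ v ∈ insert u S, (F (τ * swap u v) - F τ)) / #(insert u S)) := by
      rw [hG, permAvg_insert hu, sum_sub_distrib, sum_const, nsmul_eq_mul]
      field_simp
      ring
    rw [this, neg_sq]
    exact sq_sum_div_card_le _ _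
  calc ∑ τ, (F τ - G τ) ^ 2
      ≤ ∑ τ : Perm V, (∑ v ∈ insert u S, (F (τ * swap u v) - F τ) ^ 2) / #(insert u S) :=
        sum_le_sum fun τ _ => hpt τ
    _ = (∑ v ∈ S, swapEnergy F u v) / #(insert u S) := by
        rw [← sum_div, sum_comm, sum_insert hu]
        have h1 : (swap u u : Perm V) = 1 := swap_self u
        rw [h1]
        simp [swapEnergy]
    _ ≤ _ := by
        exact div_le_div_of_nonneg_right (sum_swapEnergy_permAvg_le hu f) hcard.le

/-- The Poincaré inequality of the random transpositions of the labels in `T`. -/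
theorem sum_sq_sub_permAvg_le (f : Perm V → ℝ) (T : Finset V) :
    #T * ∑ τ, (f τ - permAvg T f τ) ^ 2 ≤ ∑ u ∈ T, ∑ v ∈ T.erase u, swapEnergy f u v := by
  induction hm : #T generalizing T with
  | zero =>
    rw [card_eq_zero] at hm
    simp [hm]
  | succ m ih =>
    have hQ : ∀ T : Finset V, 0 ≤ ∑ u ∈ T, ∑ v ∈ T.erase u, swapEnergy f u v := fun T =>
      sum_nonneg fun _ _ => sum_nonneg fun _ _ => swapEnergy_nonneg _ _ _
    set W := ∑ τ, (f τ - permAvg T f τ) ^ 2 with hW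
    set Q := ∑ u ∈ T, ∑ v ∈ T.erase u, swapEnergy f u v with hQdef
    have hstep : ∀ u ∈ T, W ≤ ∑ τ, (f τ - permAvg (T.erase u) f τ) ^ 2
        + (∑ v ∈ T.erase u, swapEnergy f u v) / (m + 1) := by
      intro u hu
      have := sum_sq_sub_permAvg_insert_le (notMem_erase u T) f
      rw [insert_erase hu, hm] at this
      exact_mod_cast this
    rcases Nat.eq_zero_or_pos m with rfl | hmpos
    · obtain ⟨u, hu⟩ := card_eq_one.1 hm
      have h1 := hstep u (by simp [hu])
      have h2 : ∀ τ, permAvg (T.erase u) f τ = f τ := by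
        intro τ
        have h3 : T.erase u = ∅ := by simp [hu]
        have h4 : permsOn (∅ : Finset V) = {1} := by
          ext ρ; simp [mem_permsOn, Equiv.ext_iff]
        simp [permAvg, h3, h4]
      have h5 : 0 ≤ Q := hQ T
      have h6 : T.erase u = ∅ := by simp [hu]
      simp only [h2, sub_self] at h1
      simp only [h6, sum_empty] at h1
      simp at h1
      push_cast
      linarith
    · have hm' : (0 : ℝ) < m := by exact_mod_cast hmpos
      -- An ordered pair `a ≠ b` of labels survives the erasure of `u` for `m - 1` of the `m + 1`
      -- choices of `u`.
      have hcount : ∑ u ∈ T, ∑ a ∈ T.erase u, ∑ b ∈ (T.erase u).erase a, swapEnergy f a b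
          = (m - 1) * Q := by
        have h1 : ∑ u ∈ T, ∑ a ∈ T.erase u, ∑ b ∈ (T.erase u).erase a, swapEnergy f a b
            = ∑ a ∈ T, ∑ b ∈ T.erase a, ∑ u ∈ (T.erase a).erase b, swapEnergy f a b := by
          rw [sum_comm' (t' := T) (s' := fun a => T.erase a)
            (by intro x y; simp only [mem_erase]; tauto)]
          refine sum_congr rfl fun a _ => ?_
          rw [sum_comm' (t' := T.erase a) (s' := fun b => (T.erase a).erase b)
            (by intro x y; simp only [mem_erase]; tauto)]
        rw [h1, hQdef, mul_sum]
        refine sum_congr rfl fun a ha => ?_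
        rw [mul_sum]
        refine sum_congr rfl fun b hb => ?_
        rw [sum_const, nsmul_eq_mul, card_erase_of_mem hb, card_erase_of_mem ha, hm]
        congr 1
        simp only [Nat.add_sub_cancel]
        rw [Nat.cast_sub hmpos]; simp
      have hsum : ∑ u ∈ T, W ≤ ∑ u ∈ T, ((∑ a ∈ T.erase u, ∑ b ∈ (T.erase u).erase a,
          swapEnergy f a b) / m + (∑ v ∈ T.erase u, swapEnergy f u v) / (m + 1)) := by
        refine sum_le_sum fun u hu => (hstep u hu).trans ?_
        gcongr
        rw [le_div_iff₀ hm', mul_comm]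
        exact ih (T.erase u) (by rw [card_erase_of_mem hu, hm]; simp)
      rw [sum_add_distrib, ← sum_div, ← sum_div, hcount, ← hQdef, sum_const, nsmul_eq_mul,
        hm] at hsum
      refine hsum.trans ?_
      have h0 : 0 ≤ Q := hQ T
      -- The coefficient `(m - 1) / m + 1 / (m + 1)` is below 1, so averaging over `u` closes the
      -- induction with no loss in the constant.
      have : (m - 1) * Q / m + Q / (m + 1) = Q - Q / (m * (m + 1)) := by
        field_simp; ring
      rw [this]
      have : 0 ≤ Q / (m * (m + 1)) := by positivity
      linarith

end Permutations

/-! ### Functions of a tagged particle: the tag at rest. -/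

section Tagged

variable {V : Type*} [Fintype V] [DecidableEq V]

/-- `Φ` depends on the positions of the labels only through the position of the label `i₀` and
the set of the positions of the labels in `P`. -/
def IsTagged (P : Finset V) (i₀ : V) (Φ : Perm V → ℝ) : Prop :=
  ∀ ρ : Perm V, (∀ i, ρ i ∈ P ↔ i ∈ P) → ρ i₀ = i₀ → ∀ τ, Φ (τ * ρ) = Φ τ

/-- The sum of the squares of the increments of `Φ` over the jumps of a particle (a label in `P`)
to a neighbouring hole (a label outside `P`). -/
noncomputable def jumpEnergy (R : V → V → Prop) [DecidableRel R] (P : Finset V) (Φ : Perm V → ℝ) : ℝ :=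
  ∑ τ : Perm V, ∑ u : V, ∑ v : V,
    if R u v ∧ τ⁻¹ u ∈ P ∧ τ⁻¹ v ∉ P then (Φ (swap u v * τ) - Φ τ) ^ 2 else 0

theorem jumpEnergy_nonneg (R : V → V → Prop) [DecidableRel R] (P : Finset V) (Φ : Perm V → ℝ) : 0 ≤ jumpEnergy R P Φ :=
  sum_nonneg fun _ _ => sum_nonneg fun _ _ => sum_nonneg fun _ _ => by split_ifs <;> positivity

theorem swap_apply_mem_iff {α : Type*} [DecidableEq α] {P : Finset α} {a b : α}
    (h : a ∈ P ↔ b ∈ P) (i : α) : swap a b i ∈ P ↔ i ∈ P := by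
  by_cases ha : i = a
  · subst ha; simp [h]
  by_cases hb : i = b
  · subst hb; simp [h]
  rw [swap_apply_of_ne_of_ne ha hb]

/-- Exchanging two positions of equal occupation away from the tag amounts to a relabelling that
preserves `P` and `i₀`. -/
theorem IsTagged.swap_mul {V : Type*} [DecidableEq V] {P : Finset V} {i₀ : V} {Φ : Perm V → ℝ}
    (hΦ : IsTagged P i₀ Φ) {τ : Perm V} {p q : V} (hp : p ≠ τ i₀) (hq : q ≠ τ i₀)
    (h : τ⁻¹ p ∈ P ↔ τ⁻¹ q ∈ P) : Φ (swap p q * τ) = Φ τ := by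
  rw [swap_mul_eq_mul_swap]
  refine hΦ _ (swap_apply_mem_iff h) (swap_apply_of_ne_of_ne ?_ ?_) τ
  · rw [ne_comm, Ne, Perm.inv_eq_iff_eq]; exact hp
  · rw [ne_comm, Ne, Perm.inv_eq_iff_eq]; exact hq

theorem sqrt_sum_sq_add_le {ι : Type*} [Fintype ι] (f g : ι → ℝ) :
    √(∑ i, (f i + g i) ^ 2) ≤ √(∑ i, f i ^ 2) + √(∑ i, g i ^ 2) := by
  have := norm_add_le (WithLp.toLp 2 f : EuclideanSpace ℝ ι) (WithLp.toLp 2 g)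
  simpa [EuclideanSpace.norm_eq] using this

/-- The `L²` size of the exchange of the contents of `p` and `q` when the tag is at `x`. -/
noncomputable def exchangeDist (i₀ : V) (Φ : Perm V → ℝ) (x p q : V) : ℝ :=
  √(∑ τ : Perm V, (if τ i₀ = x then Φ (swap p q * τ) - Φ τ else 0) ^ 2)

theorem exchangeDist_sq (i₀ : V) (Φ : Perm V → ℝ) (x p q : V) :
    exchangeDist i₀ Φ x p q ^ 2
      = ∑ τ : Perm V, if τ i₀ = x then (Φ (swap p q * τ) - Φ τ) ^ 2 else 0 := by
  rw [exchangeDist, Real.sq_sqrt (sum_nonneg fun _ _ => sq_nonneg _)]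
  exact sum_congr rfl fun τ _ => by split_ifs <;> simp

/-- The factorisation `swap p r = swap q r * swap p q * swap q r` uses the pair `q, r` twice, which
explains the 2 in the relaxed triangle inequality; Minkowski does the rest. Away from `x`, the
intermediate placements keep the tag at `x`. -/
theorem isQuasiDist_exchangeDist (i₀ : V) (Φ : Perm V → ℝ) (x : V) :
    IsQuasiDist {x}ᶜ (exchangeDist i₀ Φ x) where
  nonneg _ _ := Real.sqrt_nonneg _
  symm p _ q _ := by simp only [exchangeDist, swap_comm p q]
  self p _ := by
    have h1 : (swap p p : Perm V) = 1 := swap_self p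
    simp only [exchangeDist]
    rw [h1]
    simp
  tri p hp q hq r hr := by
    have hnn : ∀ a b, 0 ≤ exchangeDist i₀ Φ x a b := fun _ _ => Real.sqrt_nonneg _
    have hself : ∀ a, exchangeDist i₀ Φ x a a = 0 := by
      intro a
      have h1 : (swap a a : Perm V) = 1 := swap_self a
      simp only [exchangeDist]
      rw [h1]
      simp
    by_cases hpq : p = q
    · subst hpq
      linarith [hnn p r, hself p]
    by_cases hpr : p = r
    · subst hpr
      linarith [hnn p q, hnn q p, hself p]
    have hfix : ∀ a b : V, a ∈ ({x}ᶜ : Set V) → b ∈ ({x}ᶜ : Set V) →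
        ∀ τ : Perm V, (swap a b * τ) i₀ = x ↔ τ i₀ = x := by
      intro a b ha hb τ
      have hx : swap a b x = x := swap_apply_of_ne_of_ne (Ne.symm ha) (Ne.symm hb)
      rw [Perm.mul_apply]
      constructor
      · intro h; rw [← hx] at h; exact (swap a b).injective h
      · intro h; rw [h, hx]
    have hsw : swap p r = swap q r * swap p q * swap q r := by
      rw [swap_mul_swap_mul_swap hpq hpr, swap_comm]
    let A : Perm V → ℝ := fun τ => if τ i₀ = x then Φ (swap q r * τ) - Φ τ else 0
    let B : Perm V → ℝ := fun τ => if τ i₀ = x then Φ (swap p q * τ) - Φ τ else 0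
    have hsum : ∀ τ : Perm V, (if τ i₀ = x then Φ (swap p r * τ) - Φ τ else 0)
        = (A (swap p q * (swap q r * τ)) + B (swap q r * τ)) + A τ := by
      intro τ
      simp only [A, B, hfix p q hp hq, hfix q r hq hr]
      split_ifs
      · rw [hsw]; simp only [mul_assoc]; ring
      · ring
    have e1 : ∑ τ, A (swap p q * (swap q r * τ)) ^ 2 = ∑ τ, A τ ^ 2 := by
      rw [← Equiv.sum_comp (Equiv.mulLeft (swap p q * swap q r)) fun τ => A τ ^ 2]
      simp
    have e2 : ∑ τ, B (swap q r * τ) ^ 2 = ∑ τ, B τ ^ 2 :=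
      Equiv.sum_comp (Equiv.mulLeft (swap q r)) fun τ => B τ ^ 2
    have h1 := sqrt_sum_sq_add_le (fun τ => A (swap p q * (swap q r * τ)) + B (swap q r * τ)) A
    have h2 := sqrt_sum_sq_add_le (fun τ => A (swap p q * (swap q r * τ)))
      (fun τ => B (swap q r * τ))
    rw [e1, e2] at h2
    have e3 : exchangeDist i₀ Φ x p r
        = √(∑ τ, ((A (swap p q * (swap q r * τ)) + B (swap q r * τ)) + A τ) ^ 2) := by
      simp only [exchangeDist, hsum]
    have e4 : exchangeDist i₀ Φ x p q = √(∑ τ, B τ ^ 2) := rfl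
    have e5 : exchangeDist i₀ Φ x q r = √(∑ τ, A τ ^ 2) := rfl
    rw [e3, e4, e5]
    linarith

/-- An exchange away from the tag is trivial, or is a jump in one of the two directions of the bond.
Each jump is met for both orderings of the bond, whence the factor 2. -/
theorem IsTagged.sum_energy_exchangeDist_le {R : V → V → Prop} [DecidableRel R]
    (hR : ∀ p q, R p q → R q p) {P : Finset V} {i₀ : V}
    {Φ : Perm V → ℝ} (hΦ : IsTagged P i₀ Φ) :
    ∑ x, energy R {x}ᶜ (exchangeDist i₀ Φ x) ≤ 2 * jumpEnergy R P Φ := by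
  let G : Perm V → V → V → ℝ := fun τ u v =>
    if R u v ∧ τ⁻¹ u ∈ P ∧ τ⁻¹ v ∉ P then (Φ (swap u v * τ) - Φ τ) ^ 2 else 0
  have hG : ∀ τ u v, 0 ≤ G τ u v := fun τ u v => by simp only [G]; split_ifs <;> positivity
  have h1 : ∑ x, energy R {x}ᶜ (exchangeDist i₀ Φ x)
      = ∑ τ : Perm V, ∑ p, ∑ q,
        if R p q ∧ p ≠ τ i₀ ∧ q ≠ τ i₀ then (Φ (swap p q * τ) - Φ τ) ^ 2 else 0 := by
    rw [← sum_fiberwise univ (fun τ : Perm V => τ i₀)]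
    refine sum_congr rfl fun x _ => ?_
    simp only [energy_compl, exchangeDist_sq]
    rw [sum_comm]
    rw [sum_comm (s := univ.filter fun τ : Perm V => τ i₀ = x)]
    rw [sum_comm]
    refine sum_congr rfl fun p _ => ?_
    rw [sum_comm (s := univ.filter fun τ : Perm V => τ i₀ = x)]
    refine sum_congr rfl fun q _ => ?_
    rw [sum_filter]
    split_ifs with h
    · refine sum_congr rfl fun τ _ => ?_
      split_ifs with h1 h2
      · rfl
      · subst h1; exact absurd h h2
      · rfl
    · symm
      refine sum_eq_zero fun τ _ => ?_
      split_ifs with h1 h2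
      · subst h1; exact absurd h2 h
      · rfl
      · rfl
  have h2 : 2 * jumpEnergy R P Φ = ∑ τ, ∑ p, ∑ q, (G τ p q + G τ q p) := by
    simp only [sum_add_distrib]
    have : ∀ τ : Perm V, ∑ p, ∑ q, G τ q p = ∑ p, ∑ q, G τ p q := fun τ => sum_comm
    simp only [this, jumpEnergy, G]
    ring
  rw [h1, h2]
  refine sum_le_sum fun τ _ => sum_le_sum fun p _ => sum_le_sum fun q _ => ?_
  split_ifs with h
  · by_cases hpq : τ⁻¹ p ∈ P ↔ τ⁻¹ q ∈ P
    · rw [hΦ.swap_mul h.2.1 h.2.2 hpq]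
      simpa using add_nonneg (hG τ p q) (hG τ q p)
    · by_cases hp : τ⁻¹ p ∈ P
      · have hq : τ⁻¹ q ∉ P := by tauto
        have : G τ p q = (Φ (swap p q * τ) - Φ τ) ^ 2 := if_pos ⟨h.1, hp, hq⟩
        linarith [hG τ q p]
      · have hq : τ⁻¹ q ∈ P := by tauto
        have : G τ q p = (Φ (swap p q * τ) - Φ τ) ^ 2 := by
          rw [swap_comm]; exact if_pos ⟨hR _ _ h.1, hq, hp⟩
        linarith [hG τ p q]
  · exact add_nonneg (hG τ p q) (hG τ q p)

/-- Exchanging the labels `u`, `v` is exchanging the positions `τ u`, `τ v`; the placements are then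
sorted by the position of the tag. -/
theorem sum_swapEnergy_erase_le (i₀ : V) (Φ : Perm V → ℝ) :
    ∑ u ∈ univ.erase i₀, ∑ v ∈ (univ.erase i₀).erase u, swapEnergy Φ u v
      ≤ ∑ x, ∑ p, ∑ q, if p ≠ x ∧ q ≠ x then exchangeDist i₀ Φ x p q ^ 2 else 0 := by
  have h1 : ∑ u ∈ univ.erase i₀, ∑ v ∈ (univ.erase i₀).erase u, swapEnergy Φ u v
      ≤ ∑ u ∈ univ.erase i₀, ∑ v ∈ univ.erase i₀, swapEnergy Φ u v :=
    sum_le_sum fun u _ => sum_le_sum_of_subset_of_nonneg (erase_subset _ _)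
      fun _ _ _ => swapEnergy_nonneg _ _ _
  refine h1.trans (le_of_eq ?_)
  have h2 : ∑ u ∈ univ.erase i₀, ∑ v ∈ univ.erase i₀, swapEnergy Φ u v
      = ∑ τ : Perm V, ∑ u ∈ univ.erase i₀, ∑ v ∈ univ.erase i₀,
        (Φ (swap (τ u) (τ v) * τ) - Φ τ) ^ 2 := by
    simp only [swapEnergy, mul_swap_eq_swap_mul]
    rw [sum_comm (s := (univ : Finset (Perm V)))]
    refine sum_congr rfl fun u _ => ?_
    rw [sum_comm]
  rw [h2, ← sum_fiberwise univ (fun τ : Perm V => τ i₀)]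
  refine sum_congr rfl fun x _ => ?_
  have h3 : ∀ τ ∈ univ.filter (fun τ : Perm V => τ i₀ = x),
      ∑ u ∈ univ.erase i₀, ∑ v ∈ univ.erase i₀, (Φ (swap (τ u) (τ v) * τ) - Φ τ) ^ 2
      = ∑ p, ∑ q, if p ≠ x ∧ q ≠ x then (Φ (swap p q * τ) - Φ τ) ^ 2 else 0 := by
    intro τ hτ
    rw [mem_filter] at hτ
    have hre : ∀ g : V → ℝ, ∑ u ∈ univ.erase i₀, g (τ u) = ∑ p, if p ≠ x then g p else 0 := by
      intro g
      rw [← sum_filter]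
      refine sum_equiv τ (fun i => ?_) fun i _ => rfl
      rw [mem_erase, mem_filter, ← hτ.2]
      simp
    rw [hre fun p => ∑ v ∈ univ.erase i₀, (Φ (swap p (τ v) * τ) - Φ τ) ^ 2]
    refine sum_congr rfl fun p _ => ?_
    rw [hre fun q => (Φ (swap p q * τ) - Φ τ) ^ 2]
    by_cases hp : p = x <;> simp [hp]
  rw [sum_congr rfl h3, sum_comm]
  refine sum_congr rfl fun p _ => ?_
  rw [sum_comm]
  refine sum_congr rfl fun q _ => ?_
  rw [exchangeDist_sq, sum_filter]
  split_ifs with h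
  · rfl
  · simp

end Tagged

/-! ### The joint motion of the tag and one hole. -/

section Hole

variable {V : Type*} [Fintype V] [DecidableEq V]

/-- The placements of the labels which put `i₀` at `x` and `j₀` at `h`. -/
def cell (i₀ j₀ x h : V) : Finset (Perm V) := {τ | τ i₀ = x ∧ τ j₀ = h}

theorem mem_cell {i₀ j₀ x h : V} {τ : Perm V} : τ ∈ cell i₀ j₀ x h ↔ τ i₀ = x ∧ τ j₀ = h := by
  simp [cell]

theorem sum_cell_apply (i₀ j₀ x h : V) (π : Perm V) (F : Perm V → ℝ) :
    ∑ τ ∈ cell i₀ j₀ (π x) (π h), F τ = ∑ τ ∈ cell i₀ j₀ x h, F (π * τ) := by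
  symm
  refine sum_equiv (Equiv.mulLeft π) (fun τ => ?_) fun τ _ => rfl
  simp [mem_cell]

theorem card_cell_apply (i₀ j₀ x h : V) (π : Perm V) :
    (#(cell i₀ j₀ (π x) (π h)) : ℝ) = #(cell i₀ j₀ x h) := by
  simpa using sum_cell_apply i₀ j₀ x h π fun _ => 1

theorem exists_perm_apply_pair {V : Type*} [DecidableEq V] {x h x' h' : V} (hx : x ≠ h) (hx' : x' ≠ h') :
    ∃ π : Perm V, π x = x' ∧ π h = h' := by
  refine ⟨swap (swap x x' h) h' * swap x x', ?_, by simp⟩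
  rw [Perm.mul_apply, swap_apply_left]
  refine swap_apply_of_ne_of_ne (fun h1 => hx ?_) hx'
  apply (swap x x').injective
  rw [← h1, swap_apply_left]

theorem card_cell_eq {i₀ j₀ x h : V} (hij : i₀ ≠ j₀) (hx : x ≠ h) :
    (#(cell i₀ j₀ x h) : ℝ) = #(cell i₀ j₀ i₀ j₀) := by
  obtain ⟨π, rfl, rfl⟩ := exists_perm_apply_pair hij hx
  exact card_cell_apply ..

theorem card_cell_pos (i₀ j₀ : V) : (0 : ℝ) < #(cell i₀ j₀ i₀ j₀) := by
  exact_mod_cast card_pos.2 ⟨1, by simp [mem_cell]⟩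

/-- The conditional mean of `Φ` given the positions of `i₀` and `j₀`. -/
noncomputable def cellMean (i₀ j₀ : V) (Φ : Perm V → ℝ) (x h : V) : ℝ :=
  (∑ τ ∈ cell i₀ j₀ x h, Φ τ) / #(cell i₀ j₀ x h)

/-- Left multiplication by `π` maps one cell onto the other, so the difference of means is a mean of
differences. -/
theorem sq_cellMean_sub_le (i₀ j₀ : V) (Φ : Perm V → ℝ) (x h : V) (π : Perm V) :
    (cellMean i₀ j₀ Φ (π x) (π h) - cellMean i₀ j₀ Φ x h) ^ 2
      ≤ (∑ τ ∈ cell i₀ j₀ x h, (Φ (π * τ) - Φ τ) ^ 2) / #(cell i₀ j₀ x h) := by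
  have : cellMean i₀ j₀ Φ (π x) (π h) - cellMean i₀ j₀ Φ x h
      = (∑ τ ∈ cell i₀ j₀ x h, (Φ (π * τ) - Φ τ)) / #(cell i₀ j₀ x h) := by
    rw [cellMean, cellMean, sum_cell_apply, card_cell_apply, sum_sub_distrib, sub_div]
  rw [this]
  exact sq_sum_div_card_le _ _

theorem permAvg_eq_cellMean (i₀ j₀ : V) (Φ : Perm V → ℝ) (τ : Perm V) :
    permAvg ((univ.erase i₀).erase j₀) Φ τ = cellMean i₀ j₀ Φ (τ i₀) (τ j₀) := by
  have key : ∀ F : Perm V → ℝ, ∑ ρ ∈ permsOn ((univ.erase i₀).erase j₀), F (τ * ρ)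
      = ∑ σ ∈ cell i₀ j₀ (τ i₀) (τ j₀), F σ := by
    intro F
    refine sum_equiv (Equiv.mulLeft τ) (fun ρ => ?_) fun ρ _ => rfl
    rw [mem_permsOn, mem_cell]
    simp only [mem_erase, mem_univ, and_true, not_and_or, not_not, Equiv.coe_mulLeft,
      Perm.mul_apply, EmbeddingLike.apply_eq_iff_eq]
    constructor
    · exact fun h => ⟨h i₀ (Or.inr rfl), h j₀ (Or.inl rfl)⟩
    · rintro ⟨h1, h2⟩ i (rfl | rfl)
      · exact h2
      · exact h1
  have hc := key fun _ => 1
  simp only [sum_const, nsmul_eq_mul, mul_one] at hc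
  rw [permAvg, cellMean, key, hc]

theorem sum_cell_sum {i₀ j₀ : V} (F : V → V → Perm V → ℝ) :
    ∑ x, ∑ h, ∑ τ ∈ cell i₀ j₀ x h, F x h τ = ∑ τ : Perm V, F (τ i₀) (τ j₀) τ := by
  rw [← sum_fiberwise univ (fun τ : Perm V => τ i₀)]
  refine sum_congr rfl fun x _ => ?_
  rw [← sum_fiberwise _ (fun τ : Perm V => τ j₀)]
  refine sum_congr rfl fun h _ => ?_
  rw [filter_filter]
  refine sum_congr rfl fun τ hτ => ?_
  have hτ' := (mem_filter.1 hτ).2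
  rw [hτ'.1, hτ'.2]

theorem sum_apply_eq {i₀ j₀ : V} (hij : i₀ ≠ j₀) (g : V → ℝ) :
    ∑ τ : Perm V, g (τ i₀)
      = #(cell i₀ j₀ i₀ j₀) * (Fintype.card V - 1) * ∑ x, g x := by
  rw [← sum_cell_sum (i₀ := i₀) (j₀ := j₀) fun x _ _ => g x, mul_sum]
  refine sum_congr rfl fun x _ => ?_
  have h1 : ∀ h, ∑ τ ∈ cell i₀ j₀ x h, g x
      = if h = x then 0 else #(cell i₀ j₀ i₀ j₀) * g x := by
    intro h
    split_ifs with hx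
    · subst hx
      have : cell i₀ j₀ h h = ∅ := by
        ext τ
        simp only [mem_cell, notMem_empty, iff_false, not_and]
        exact fun h1 h2 => hij (τ.injective (h1.trans h2.symm))
      simp [this]
    · rw [sum_const, nsmul_eq_mul, card_cell_eq hij (Ne.symm hx)]
  simp only [h1]
  rw [← add_sum_erase _ _ (mem_univ x), if_pos rfl, zero_add,
    sum_congr rfl fun h hh => if_neg (mem_erase.1 hh).1]
  rw [sum_const, card_erase_of_mem (mem_univ x), card_univ, nsmul_eq_mul,
    Nat.cast_sub (Fintype.card_pos_iff.2 ⟨x⟩)]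
  push_cast
  ring

variable {R : V → V → Prop} [DecidableRel R]

/-- The sum of the squares of the increments of `Φ` over the exchanges of the content of the
position of `j` with a neighbour. -/
noncomputable def holeEnergy (R : V → V → Prop) [DecidableRel R] (Φ : Perm V → ℝ) (j : V) : ℝ :=
  ∑ τ : Perm V, ∑ v, if R (τ j) v then (Φ (swap (τ j) v * τ) - Φ τ) ^ 2 else 0

theorem holeEnergy_eq (Φ : Perm V → ℝ) (i₀ j₀ : V) :
    holeEnergy R Φ j₀ = ∑ x, ∑ h, ∑ v, if R h v then
      ∑ τ ∈ cell i₀ j₀ x h, (Φ (swap h v * τ) - Φ τ) ^ 2 else 0 := by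
  rw [holeEnergy, ← sum_cell_sum (i₀ := i₀) (j₀ := j₀)
    fun _ h τ => ∑ v, if R h v then (Φ (swap h v * τ) - Φ τ) ^ 2 else 0]
  refine sum_congr rfl fun x _ => sum_congr rfl fun h _ => ?_
  rw [sum_comm]
  refine sum_congr rfl fun v _ => ?_
  split_ifs <;> simp

theorem sum_energy_cellMean_le {i₀ j₀ : V} (hij : i₀ ≠ j₀) (Φ : Perm V → ℝ) :
    #(cell i₀ j₀ i₀ j₀) * ∑ x, energy R {x}ᶜ
      (fun h v => |cellMean i₀ j₀ Φ x h - cellMean i₀ j₀ Φ x v|) ≤ holeEnergy R Φ j₀ := by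
  rw [holeEnergy_eq Φ i₀, mul_sum]
  refine sum_le_sum fun x _ => ?_
  rw [energy_compl, mul_sum]
  refine sum_le_sum fun h _ => ?_
  rw [mul_sum]
  refine sum_le_sum fun v _ => ?_
  by_cases hc : R h v ∧ h ≠ x ∧ v ≠ x
  · rw [if_pos hc, if_pos hc.1, sq_abs]
    have h1 := sq_cellMean_sub_le i₀ j₀ Φ x h (swap h v)
    rw [swap_apply_of_ne_of_ne hc.2.1.symm hc.2.2.symm, swap_apply_left,
      card_cell_eq hij hc.2.1.symm, le_div_iff₀ (card_cell_pos i₀ j₀)] at h1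
    linarith
  · rw [if_neg hc, mul_zero]
    split_ifs
    · exact sum_nonneg fun _ _ => sq_nonneg _
    · exact le_rfl

/-- These are the terms of the hole energy in which the hole is exchanged with the tag, the ones
that move the tag. -/
theorem sum_sq_cellMean_swap_le (hirr : ∀ x, ¬ R x x) {i₀ j₀ : V} (hij : i₀ ≠ j₀)
    (Φ : Perm V → ℝ) :
    #(cell i₀ j₀ i₀ j₀) * ∑ x, ∑ y, (if R y x then
      (cellMean i₀ j₀ Φ x y - cellMean i₀ j₀ Φ y x) ^ 2 else 0) ≤ holeEnergy R Φ j₀ := by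
  rw [holeEnergy_eq Φ i₀, mul_sum]
  refine sum_le_sum fun x _ => ?_
  rw [mul_sum]
  refine sum_le_sum fun h _ => ?_
  have hnn : ∀ v, 0 ≤ if R h v then
      ∑ τ ∈ cell i₀ j₀ x h, (Φ (swap h v * τ) - Φ τ) ^ 2 else 0 := fun v => by
    split_ifs
    · exact sum_nonneg fun _ _ => sq_nonneg _
    · exact le_rfl
  refine le_trans ?_ (single_le_sum (fun v _ => hnn v) (mem_univ x))
  split_ifs with hc
  · have hx : x ≠ h := fun e => hirr x (by rw [← e] at hc; exact hc)
    have h1 := sq_cellMean_sub_le i₀ j₀ Φ x h (swap h x)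
    rw [swap_apply_left, swap_apply_right, card_cell_eq hij hx,
      le_div_iff₀ (card_cell_pos i₀ j₀)] at h1
    have h2 : (cellMean i₀ j₀ Φ x h - cellMean i₀ j₀ Φ h x) ^ 2
      = (cellMean i₀ j₀ Φ h x - cellMean i₀ j₀ Φ x h) ^ 2 := by ring
    rw [h2]
    linarith
  · simp

theorem IsTagged.holeEnergy_eq {P : Finset V} {i₀ : V} {Φ : Perm V → ℝ} (hΦ : IsTagged P i₀ Φ)
    (hi₀ : i₀ ∈ P) {j j₀ : V} (hj : j ∉ P) (hj₀ : j₀ ∉ P) :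
    holeEnergy R Φ j = holeEnergy R Φ j₀ := by
  have hinv : ∀ τ, Φ (τ * swap j j₀) = Φ τ :=
    hΦ _ (swap_apply_mem_iff (by tauto)) (swap_apply_of_ne_of_ne (by rintro rfl; exact hj hi₀)
      (by rintro rfl; exact hj₀ hi₀))
  unfold holeEnergy
  rw [← Equiv.sum_comp (Equiv.mulRight (swap j j₀))]
  refine sum_congr rfl fun τ _ => ?_
  simp only [Equiv.coe_mulRight, Perm.mul_apply, swap_apply_left, ← mul_assoc, hinv]

/-- All holes have equal energy because `Φ` ignores their labels. Summed over the holes, hole-hole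
exchanges vanish and each hole-particle exchange is one jump. -/
theorem IsTagged.card_mul_holeEnergy_le (hR : ∀ p q, R p q → R q p) {P : Finset V} {i₀ : V}
    {Φ : Perm V → ℝ} (hΦ : IsTagged P i₀ Φ) (hi₀ : i₀ ∈ P) {j₀ : V} (hj₀ : j₀ ∉ P) :
    #Pᶜ * holeEnergy R Φ j₀ ≤ jumpEnergy R P Φ := by
  have h1 : #Pᶜ * holeEnergy R Φ j₀ = ∑ j ∈ Pᶜ, holeEnergy R Φ j := by
    rw [← nsmul_eq_mul, ← sum_const]
    exact sum_congr rfl fun j hj => (hΦ.holeEnergy_eq hi₀ (mem_compl.1 hj) hj₀).symm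
  have h2 : ∑ j ∈ Pᶜ, holeEnergy R Φ j = ∑ τ : Perm V, ∑ h, if τ⁻¹ h ∉ P then
      ∑ v, (if R h v then (Φ (swap h v * τ) - Φ τ) ^ 2 else 0) else 0 := by
    unfold holeEnergy
    rw [sum_comm]
    refine sum_congr rfl fun τ _ => ?_
    rw [← sum_filter]
    refine sum_equiv τ (fun j => ?_) fun j _ => rfl
    simp
  rw [h1, h2, jumpEnergy]
  refine sum_le_sum fun τ _ => ?_
  rw [sum_comm (f := fun u v => if R u v ∧ τ⁻¹ u ∈ P ∧ τ⁻¹ v ∉ P then _ else _)]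
  refine sum_le_sum fun h _ => ?_
  by_cases hh : τ⁻¹ h ∉ P
  · rw [if_pos hh]
    refine sum_le_sum fun v _ => ?_
    by_cases hv : τ⁻¹ v ∈ P
    · by_cases hhv : R h v
      · rw [if_pos hhv, if_pos ⟨hR _ _ hhv, hv, hh⟩, swap_comm]
      · rw [if_neg hhv]; split_ifs <;> positivity
    · rw [if_neg (c := R v h ∧ τ⁻¹ v ∈ P ∧ τ⁻¹ h ∉ P) fun h' => hv h'.2.1]
      split_ifs
      · have hne : ∀ w, τ⁻¹ w ∉ P → w ≠ τ i₀ := by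
          rintro w hw rfl; exact hw (by simpa using hi₀)
        rw [hΦ.swap_mul (hne h hh) (hne v hv) (by tauto)]
        simp
      · exact le_rfl
  · rw [if_neg hh]
    exact sum_nonneg fun _ _ => by split_ifs <;> positivity

/-! ### The Poincaré inequality for a tagged particle. -/

/-- The geometric properties of the box of side `2n+1` which enter the Poincaré inequalities. -/
structure IsGridLike (R : V → V → Prop) [DecidableRel R] (n : ℕ) : Prop where
  one_le : 1 ≤ n
  card_eq : Fintype.card V = (2 * n + 1) ^ 2
  symm : ∀ p q, R p q → R q p
  irrefl : ∀ p, ¬ R p p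
  exists_adj : ∀ x, ∃ y, R x y
  card_adj_le : ∀ x, #{y | R x y} ≤ 4
  sum_sq_le : ∀ s : V → V → ℝ, IsQuasiDist Set.univ s →
    ∑ p, ∑ q, s p q ^ 2 ≤ 1728 * (n : ℝ) ^ 4 * energy R Set.univ s
  sum_sq_le_compl : ∀ (x : V) (s : V → V → ℝ), IsQuasiDist {x}ᶜ s →
    ∑ p, ∑ q, (if p ≠ x ∧ q ≠ x then s p q ^ 2 else 0)
      ≤ 4480704 * (n : ℝ) ^ 4 * energy R {x}ᶜ s
  sq_le_compl : ∀ (x : V) (s : V → V → ℝ), IsQuasiDist {x}ᶜ s → ∀ p q, p ≠ x → q ≠ x →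
    s p q ^ 2 ≤ 165952 * n * energy R {x}ᶜ s
  sq_le_detour : ∀ (x : V) (s : V → V → ℝ), IsQuasiDist {x}ᶜ s → ∀ p q, R x p → R x q →
    s p q ^ 2 ≤ 324 * energy R {x}ᶜ s

theorem isQuasiDist_abs_sub {V : Type*} (S : Set V) (u : V → ℝ) : IsQuasiDist S fun p q => |u p - u q| where
  nonneg _ _ := abs_nonneg _
  symm _ _ _ _ := abs_sub_comm _ _
  self _ _ := by simp
  tri p _ q _ r _ := by
    have := abs_sub_le (u p) (u q) (u r)
    have := abs_nonneg (u q - u r)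
    linarith

/-- Random transpositions of the labels other than the tag, compared with nearest-neighbour
exchanges. Dividing the path factor `n ^ 4` by the number of labels, at least `4 * n ^ 2`, leaves `n
^ 2`. -/
theorem IsGridLike.sum_sq_sub_permAvg_le {n : ℕ} (hG : IsGridLike R n) {P : Finset V} {i₀ : V}
    {Φ : Perm V → ℝ} (hΦ : IsTagged P i₀ Φ) :
    ∑ τ, (Φ τ - permAvg (univ.erase i₀) Φ τ) ^ 2 ≤ 2240352 * n ^ 2 * jumpEnergy R P Φ := by
  have hn : (1 : ℝ) ≤ n := by exact_mod_cast hG.one_le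
  have hJ := jumpEnergy_nonneg R P Φ
  have h1 := APLG.sum_sq_sub_permAvg_le Φ (univ.erase i₀)
  have hc : (#(univ.erase i₀) : ℝ) = (2 * n + 1) ^ 2 - 1 := by
    rw [card_erase_of_mem (mem_univ _), card_univ, hG.card_eq, Nat.cast_sub (by
      exact Nat.one_le_pow _ _ (by omega))]
    push_cast; ring
  have h2 := h1.trans (sum_swapEnergy_erase_le i₀ Φ)
  have h3 : ∑ x, ∑ p, ∑ q, (if p ≠ x ∧ q ≠ x then exchangeDist i₀ Φ x p q ^ 2 else 0)
      ≤ 4480704 * (n : ℝ) ^ 4 * (2 * jumpEnergy R P Φ) := by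
    refine (sum_le_sum fun x _ => hG.sum_sq_le_compl x _ (isQuasiDist_exchangeDist i₀ Φ x)).trans ?_
    rw [← mul_sum]
    exact mul_le_mul_of_nonneg_left (hΦ.sum_energy_exchangeDist_le hG.symm) (by positivity)
  have h4 := h2.trans h3
  rw [hc] at h4
  have hW : 0 ≤ ∑ τ, (Φ τ - permAvg (univ.erase i₀) Φ τ) ^ 2 := sum_nonneg fun _ _ => sq_nonneg _
  set W := ∑ τ, (Φ τ - permAvg (univ.erase i₀) Φ τ) ^ 2
  have h5 : 4 * (n : ℝ) ^ 2 * W ≤ ((2 * n + 1) ^ 2 - 1) * W := by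
    apply mul_le_mul_of_nonneg_right _ hW
    nlinarith
  have h6 : 0 < 4 * (n : ℝ) ^ 2 := by positivity
  refine le_of_mul_le_mul_left ((h5.trans h4).trans (le_of_eq ?_)) h6
  ring

/-- The hole is docked at `k x` when the tag is at `x`. To move the tag to a neighbour `y`, the hole
goes round `x` to `y`, is exchanged with the tag, and goes round `y` to `k y`. Three terms, four
neighbours and two endpoints give `7776 = 3 * 4 * 2 * 324`. -/
theorem IsGridLike.sum_sq_docked_le {n : ℕ} (hG : IsGridLike R n) (U : V → V → ℝ) (k : V → V)
    (hk : ∀ x, R x (k x)) :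
    ∑ x, ∑ y, (U x (k x) - U y (k y)) ^ 2 ≤ 1728 * (n : ℝ) ^ 4 *
      (7776 * ∑ x, energy R {x}ᶜ (fun h v => |U x h - U x v|)
        + 3 * ∑ x, ∑ y, (if R y x then (U x y - U y x) ^ 2 else 0)) := by
  have h1 := hG.sum_sq_le _ (isQuasiDist_abs_sub Set.univ fun x => U x (k x))
  simp only [sq_abs] at h1
  refine h1.trans ?_
  gcongr
  rw [energy_univ]
  simp only [sq_abs]
  set E : V → ℝ := fun x => energy R {x}ᶜ (fun h v => |U x h - U x v|) with hE
  have hE0 : ∀ x, 0 ≤ E x := fun x => energy_nonneg _ _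
  have hdet : ∀ x p q, R x p → R x q → (U x p - U x q) ^ 2 ≤ 324 * E x := by
    intro x p q hp hq
    have := hG.sq_le_detour x _ (isQuasiDist_abs_sub {x}ᶜ (U x)) p q hp hq
    simpa only [sq_abs] using this
  have hpt : ∀ x y, (if R x y then (U x (k x) - U y (k y)) ^ 2 else 0)
      ≤ (if R x y then 972 * E x else 0) + (if R y x then 972 * E y else 0)
        + 3 * (if R y x then (U x y - U y x) ^ 2 else 0) := by
    intro x y
    by_cases h : R x y
    · have h' := hG.symm _ _ h
      simp only [h, h', if_true]
      have a := hdet x (k x) y (hk x) h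
      have b := hdet y x (k y) h' (hk y)
      nlinarith [sq_nonneg ((U x (k x) - U x y) - (U x y - U y x)),
        sq_nonneg ((U x (k x) - U x y) - (U y x - U y (k y))),
        sq_nonneg ((U x y - U y x) - (U y x - U y (k y)))]
    · have h' : ¬ R y x := fun h' => h (hG.symm _ _ h')
      simp [h, h']
  refine (sum_le_sum fun x _ => sum_le_sum fun y _ => hpt x y).trans ?_
  simp only [sum_add_distrib]
  have hdeg : ∑ x, ∑ y, (if R x y then 972 * E x else 0) ≤ 3888 * ∑ x, E x := by
    rw [mul_sum]
    refine sum_le_sum fun x _ => ?_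
    rw [← sum_filter, sum_const, nsmul_eq_mul]
    have : (#{y | R x y} : ℝ) ≤ 4 := by exact_mod_cast hG.card_adj_le x
    nlinarith [hE0 x]
  have hsw : ∑ x, ∑ y, (if R y x then 972 * E y else 0)
      = ∑ x, ∑ y, (if R x y then 972 * E x else 0) := sum_comm
  have hmul : ∑ x, ∑ y, 3 * (if R y x then (U x y - U y x) ^ 2 else 0)
      = 3 * ∑ x, ∑ y, (if R y x then (U x y - U y x) ^ 2 else 0) := by
    simp only [mul_sum]
  rw [hsw, hmul]
  linarith

theorem exists_sum_sq_sub_le {V : Type*} [Fintype V] [Nonempty V] (d : V → ℝ) :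
    ∃ c, Fintype.card V * ∑ x, (d x - c) ^ 2 ≤ ∑ x, ∑ y, (d x - d y) ^ 2 := by
  have hV : (0 : ℝ) < Fintype.card V := by exact_mod_cast Fintype.card_pos
  refine ⟨(∑ y, d y) / Fintype.card V, ?_⟩
  rw [mul_sum]
  refine sum_le_sum fun x _ => ?_
  have h1 := sq_sum_div_card_le univ fun y => d x - d y
  have h2 : (∑ y, (d x - d y)) / (#(univ : Finset V) : ℝ) = d x - (∑ y, d y) / Fintype.card V := by
    rw [sum_sub_distrib, sum_const, nsmul_eq_mul, card_univ]; field_simp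
  rw [h2, card_univ, le_div_iff₀ hV] at h1
  linarith

/-- The Poincaré inequality for a tagged particle and its environment. -/
theorem IsGridLike.tagged_poincare {n : ℕ} (hG : IsGridLike R n) {P : Finset V} {i₀ : V}
    (hi₀ : i₀ ∈ P) {β : ℝ} (hβ0 : 0 < β) (hβ1 : β ≤ 1) (hβ : β * Fintype.card V ≤ #Pᶜ)
    {Φ : Perm V → ℝ} (hΦ : IsTagged P i₀ Φ) (hmean : ∑ τ, Φ τ = 0) :
    ∑ τ, Φ τ ^ 2 ≤ 20000000 / β * n ^ 2 * jumpEnergy R P Φ := by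
  have hn : (1 : ℝ) ≤ n := by exact_mod_cast hG.one_le
  have hJ := jumpEnergy_nonneg R P Φ
  have hcard : (Fintype.card V : ℝ) = (2 * n + 1) ^ 2 := by rw [hG.card_eq]; push_cast; ring
  have hcard1 : 4 * (n : ℝ) ^ 2 ≤ Fintype.card V := by rw [hcard]; nlinarith
  have hcard0 : (0 : ℝ) < Fintype.card V := by rw [hcard]; positivity
  have hH : (0 : ℝ) < #Pᶜ := lt_of_lt_of_le (by positivity) hβ
  obtain ⟨j₀, hj₀⟩ : (Pᶜ).Nonempty := card_pos.1 (by exact_mod_cast hH)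
  rw [mem_compl] at hj₀
  have hij : i₀ ≠ j₀ := by rintro rfl; exact hj₀ hi₀
  have : Nonempty V := ⟨i₀⟩
  choose k hk using hG.exists_adj
  have hkne : ∀ x, k x ≠ x := fun x h => hG.irrefl x (by have := hk x; rwa [h] at this)
  set U := cellMean i₀ j₀ Φ with hU
  set E : V → ℝ := fun x => energy R {x}ᶜ (fun h v => |U x h - U x v|) with hE
  set c₂ : ℝ := (#(cell i₀ j₀ i₀ j₀) : ℝ) with hc₂
  have hc₂0 : 0 < c₂ := card_cell_pos i₀ j₀
  set h₀ := holeEnergy R Φ j₀ with hh₀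
  set J := jumpEnergy R P Φ with hJdef
  have hE1 : c₂ * ∑ x, E x ≤ h₀ := sum_energy_cellMean_le hij Φ
  have hX1 := sum_sq_cellMean_swap_le (R := R) hG.irrefl hij Φ
  have hHJ : #Pᶜ * h₀ ≤ J := hΦ.card_mul_holeEnergy_le hG.symm hi₀ hj₀
  have hh₀0 : 0 ≤ h₀ := by
    refine le_trans (mul_nonneg hc₂0.le (sum_nonneg fun x _ => energy_nonneg _ _)) hE1
  have hNh : Fintype.card V * h₀ ≤ J / β := by
    rw [le_div_iff₀ hβ0]
    nlinarith
  have hdock := hG.sum_sq_docked_le U k hk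
  obtain ⟨c, hc⟩ := exists_sum_sq_sub_le fun x => U x (k x)
  -- the conditional mean given the position of the tag
  have hA := hG.sum_sq_sub_permAvg_le hΦ
  -- Given the tag, the mean of `Φ` is the average of `U` over the positions of the hole, so the
  -- pointwise path bound compares it with the docked value.
  have hB : ∑ τ, (permAvg (univ.erase i₀) Φ τ - U (τ i₀) (k (τ i₀))) ^ 2
      ≤ 165952 * n * ((Fintype.card V - 1) * h₀) := by
    have hpt : ∀ τ : Perm V, (permAvg (univ.erase i₀) Φ τ - U (τ i₀) (k (τ i₀))) ^ 2
        ≤ 165952 * n * E (τ i₀) := by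
      intro τ
      have hins : insert j₀ ((univ.erase i₀).erase j₀) = univ.erase i₀ :=
        insert_erase (by simp [hij.symm])
      have hT : (0 : ℝ) < #(univ.erase i₀) := by
        exact_mod_cast card_pos.2 ⟨j₀, by simp [hij.symm]⟩
      have e1 : permAvg (univ.erase i₀) Φ τ - U (τ i₀) (k (τ i₀))
          = (∑ v ∈ univ.erase i₀, (U (τ i₀) (τ v) - U (τ i₀) (k (τ i₀))))
            / #(univ.erase i₀) := by
        have := permAvg_insert (notMem_erase j₀ (univ.erase i₀)) Φ τ
        rw [hins] at this
        rw [this, sum_sub_distrib, sum_const, nsmul_eq_mul, sub_div, mul_div_cancel_left₀ _ hT.ne']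
        congr 2
        refine sum_congr rfl fun v hv => ?_
        rw [permAvg_eq_cellMean, Perm.mul_apply, Perm.mul_apply, swap_apply_left,
          swap_apply_of_ne_of_ne hij (mem_erase.1 hv).1.symm]
      rw [e1]
      refine (sq_sum_div_card_le _ _).trans ?_
      rw [div_le_iff₀ hT, mul_comm, ← nsmul_eq_mul, ← sum_const]
      refine sum_le_sum fun v hv => ?_
      have := hG.sq_le_compl (τ i₀) _ (isQuasiDist_abs_sub {τ i₀}ᶜ (U (τ i₀))) (τ v) (k (τ i₀))
        (fun h => (mem_erase.1 hv).1 (τ.injective h)) (hkne _)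
      simpa only [sq_abs] using this
    refine (sum_le_sum fun τ _ => hpt τ).trans ?_
    rw [← mul_sum, sum_apply_eq hij]
    refine mul_le_mul_of_nonneg_left ?_ (by positivity)
    have : (0 : ℝ) ≤ Fintype.card V - 1 := by nlinarith
    linarith [mul_le_mul_of_nonneg_left hE1 this]
  -- Here `7779 = 7776 + 3` and `13442112 = 1728 * 7779`.
  have hC : ∑ τ : Perm V, (U (τ i₀) (k (τ i₀)) - c) ^ 2 ≤ 13442112 * (n : ℝ) ^ 4 * h₀ := by
    rw [sum_apply_eq hij fun x => (U x (k x) - c) ^ 2]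
    have h1 : c₂ * (Fintype.card V * ∑ x, (U x (k x) - c) ^ 2)
        ≤ c₂ * (1728 * (n : ℝ) ^ 4 * (7776 * ∑ x, E x
          + 3 * ∑ x, ∑ y, (if R y x then (U x y - U y x) ^ 2 else 0))) :=
      mul_le_mul_of_nonneg_left (hc.trans hdock) hc₂0.le
    have h2 : c₂ * (7776 * ∑ x, E x
          + 3 * ∑ x, ∑ y, (if R y x then (U x y - U y x) ^ 2 else 0)) ≤ 7779 * h₀ := by
      rw [mul_add]; linarith
    have h3 := mul_le_mul_of_nonneg_left h2 (by positivity : (0 : ℝ) ≤ 1728 * (n : ℝ) ^ 4)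
    have h4 : 0 ≤ c₂ * ∑ x, (U x (k x) - c) ^ 2 :=
      mul_nonneg hc₂0.le (sum_nonneg fun _ _ => sq_nonneg _)
    linarith
  have hsplit : ∑ τ, (Φ τ - c) ^ 2 ≤ 2 * ∑ τ, (Φ τ - permAvg (univ.erase i₀) Φ τ) ^ 2
      + 4 * ∑ τ, (permAvg (univ.erase i₀) Φ τ - U (τ i₀) (k (τ i₀))) ^ 2
      + 4 * ∑ τ : Perm V, (U (τ i₀) (k (τ i₀)) - c) ^ 2 := by
    simp only [mul_sum]
    rw [← sum_add_distrib, ← sum_add_distrib]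
    refine sum_le_sum fun τ _ => ?_
    nlinarith [sq_nonneg ((Φ τ - permAvg (univ.erase i₀) Φ τ) -
      (permAvg (univ.erase i₀) Φ τ - c)), sq_nonneg ((permAvg (univ.erase i₀) Φ τ
      - U (τ i₀) (k (τ i₀))) - (U (τ i₀) (k (τ i₀)) - c))]
  have hvar : ∑ τ, Φ τ ^ 2 ≤ ∑ τ, (Φ τ - c) ^ 2 := by
    have : ∑ τ, (Φ τ - c) ^ 2 = ∑ τ, Φ τ ^ 2 + ∑ τ : Perm V, c ^ 2 := by
      have e : ∑ τ, (Φ τ - c) ^ 2 = ∑ τ, (Φ τ ^ 2 + c ^ 2 - 2 * c * Φ τ) :=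
        sum_congr rfl fun τ _ => by ring
      rw [e, sum_sub_distrib, sum_add_distrib, ← mul_sum, hmean]; ring
    rw [this]
    have : 0 ≤ ∑ τ : Perm V, c ^ 2 := sum_nonneg fun _ _ => sq_nonneg _
    linarith
  have hJβ : J ≤ J / β := by rw [le_div_iff₀ hβ0]; nlinarith
  have hJβ0 : 0 ≤ J / β := by positivity
  have b1 : (n : ℝ) ^ 2 * J ≤ n ^ 2 * (J / β) := by gcongr
  have b2 : n * ((Fintype.card V - 1) * h₀) ≤ n ^ 2 * (J / β) := by
    have : (Fintype.card V - 1) * h₀ ≤ J / β := by linarith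
    calc n * ((Fintype.card V - 1) * h₀) ≤ n * (J / β) := by gcongr
      _ ≤ n ^ 2 * (J / β) := mul_le_mul_of_nonneg_right (by nlinarith) hJβ0
  have b3 : (n : ℝ) ^ 4 * h₀ ≤ n ^ 2 * (J / β) / 4 := by
    have : 4 * (n : ℝ) ^ 2 * h₀ ≤ J / β :=
      (mul_le_mul_of_nonneg_right hcard1 hh₀0).trans hNh
    linarith [mul_le_mul_of_nonneg_left this (by positivity : (0 : ℝ) ≤ (n : ℝ) ^ 2)]
  have hfin : 20000000 / β * n ^ 2 * J = 20000000 * (n ^ 2 * (J / β)) := by ring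
  have b4 : 0 ≤ (n : ℝ) ^ 2 * (J / β) := by positivity
  -- The three contributions add up to `2 * 2240352 + 4 * 165952 + 13442112 = 18586624`.
  rw [hfin]
  linarith

end Hole

/-! ### Decoupling of the particles. -/

section Kernels

variable {V : Type*} [Fintype V] [DecidableEq V]

/-- `h` depends on the positions of the labels only through the set of the positions of `P`. -/
def IsBlind (P : Finset V) (h : Perm V → ℝ) : Prop :=
  ∀ ρ : Perm V, (∀ i, ρ i ∈ P ↔ i ∈ P) → ∀ τ, h (τ * ρ) = h τ

/-- `m i k τ` is a function of `i`, of the position of `k`, and of the set of the positions of the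
labels in `P`. -/
def IsKernel (P : Finset V) (m : V → V → Perm V → ℝ) : Prop :=
  ∀ ρ : Perm V, (∀ i, ρ i ∈ P ↔ i ∈ P) → ∀ i k τ, m i k (τ * ρ) = m i (ρ k) τ

/-- The matrices `m i k τ`, `i k ∈ P`, have vanishing row and column sums. -/
structure IsCentred (P : Finset V) (m : V → V → Perm V → ℝ) : Prop where
  row : ∀ i ∈ P, ∀ τ, ∑ k ∈ P, m i k τ = 0
  col : ∀ k ∈ P, ∀ τ, ∑ i ∈ P, m i k τ = 0

variable {P : Finset V} {m : V → V → Perm V → ℝ}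

theorem IsKernel.sum_mul_eq (hm : IsKernel P m) {h : Perm V → ℝ} {j k : V} (hj : j ∈ P)
    (hk : k ∈ P) (hh : ∀ τ, h (τ * swap j k) = h τ) :
    ∑ τ, h τ * m j k τ = ∑ τ, h τ * m j j τ := by
  rw [← Equiv.sum_comp (Equiv.mulRight (swap j k)) fun τ => h τ * m j j τ]
  refine sum_congr rfl fun τ _ => ?_
  simp only [Equiv.coe_mulRight]
  rw [hh, hm _ (swap_apply_mem_iff (by tauto)), swap_apply_left]

theorem IsKernel.sum_blind_mul_eq_zero (hm : IsKernel P m) (hc : IsCentred P m)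
    {h : Perm V → ℝ} (hh : IsBlind P h) {i : V} (hi : i ∈ P) : ∑ τ, h τ * m i i τ = 0 := by
  have hK : (0 : ℝ) < #P := by exact_mod_cast card_pos.2 ⟨i, hi⟩
  have h1 : (#P : ℝ) * ∑ τ, h τ * m i i τ = ∑ k ∈ P, ∑ τ, h τ * m i k τ := by
    rw [← nsmul_eq_mul, ← sum_const]
    exact sum_congr rfl fun k hk => (hm.sum_mul_eq hi hk
      (hh _ (swap_apply_mem_iff (by tauto)))).symm
  rw [sum_comm] at h1
  simp only [← mul_sum, hc.row i hi, mul_zero, sum_const_zero] at h1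
  exact (mul_eq_zero.1 h1).resolve_left hK.ne'

/-- For `j ≠ i`, relabelling replaces `m j j` by the average of `m j k` over `k ≠ i`, which the row
sums turn into `-m j i / (#P - 1)`. Summing over `j ≠ i`, the column sums give back `m i i ^ 2 / (#P
- 1)`. -/
theorem IsKernel.card_sub_one_mul_sum_sq (hm : IsKernel P m) (hc : IsCentred P m) :
    ((#P : ℝ) - 1) * ∑ τ, (∑ i ∈ P, m i i τ) ^ 2 = #P * ∑ i ∈ P, ∑ τ, m i i τ ^ 2 := by
  have hpair : ∀ i ∈ P, ∀ j ∈ P.erase i,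
      ((#P : ℝ) - 1) * ∑ τ, m i i τ * m j j τ = -∑ τ, m i i τ * m j i τ := by
    intro i hi j hj
    rw [mem_erase] at hj
    have hcard : ((#P : ℝ) - 1) = #(P.erase i) := by
      rw [card_erase_of_mem hi, Nat.cast_sub (card_pos.2 ⟨i, hi⟩)]; simp
    have h1 : (#(P.erase i) : ℝ) * ∑ τ, m i i τ * m j j τ
        = ∑ k ∈ P.erase i, ∑ τ, m i i τ * m j k τ := by
      rw [← nsmul_eq_mul, ← sum_const]
      refine sum_congr rfl fun k hk => ?_
      rw [mem_erase] at hk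
      refine (hm.sum_mul_eq hj.2 hk.2 fun τ => ?_).symm
      rw [hm _ (swap_apply_mem_iff (by tauto)), swap_apply_of_ne_of_ne hj.1.symm hk.1.symm]
    rw [hcard, h1, sum_comm, ← sum_neg_distrib]
    refine sum_congr rfl fun τ _ => ?_
    have h2 := hc.row j hj.2 τ
    rw [← add_sum_erase _ _ hi] at h2
    rw [← mul_sum, eq_neg_of_add_eq_zero_right h2]
    ring
  have hdiag : ∀ i ∈ P, ((#P : ℝ) - 1) * ∑ j ∈ P, ∑ τ, m i i τ * m j j τ
      = #P * ∑ τ, m i i τ ^ 2 := by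
    intro i hi
    rw [← add_sum_erase _ _ hi, mul_add, mul_sum (s := P.erase i), sum_congr rfl (hpair i hi),
      sum_neg_distrib, sum_comm]
    have h1 : ∀ τ, ∑ j ∈ P.erase i, m i i τ * m j i τ = -(m i i τ ^ 2) := by
      intro τ
      have h2 := hc.col i hi τ
      rw [← add_sum_erase _ _ hi] at h2
      rw [← mul_sum, eq_neg_of_add_eq_zero_right h2]
      ring
    simp only [h1, sum_neg_distrib, ← pow_two]
    ring
  have hsq : ∑ τ, (∑ i ∈ P, m i i τ) ^ 2 = ∑ i ∈ P, ∑ j ∈ P, ∑ τ, m i i τ * m j j τ := by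
    simp only [pow_two, sum_mul_sum]
    rw [sum_comm]
    exact sum_congr rfl fun i _ => sum_comm
  rw [hsq, mul_sum, sum_congr rfl hdiag, mul_sum]

/-- The factor `#P / (#P - 1)` lies between 1 and 2 once `#P ≥ 2`; when `#P = 1` the identity itself
makes `m i i` vanish. -/
theorem IsKernel.sum_sq_bounds (hm : IsKernel P m) (hc : IsCentred P m) :
    ∑ i ∈ P, ∑ τ, m i i τ ^ 2 ≤ ∑ τ, (∑ i ∈ P, m i i τ) ^ 2 ∧
      ∑ τ, (∑ i ∈ P, m i i τ) ^ 2 ≤ 2 * ∑ i ∈ P, ∑ τ, m i i τ ^ 2 := by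
  have hS : 0 ≤ ∑ i ∈ P, ∑ τ, m i i τ ^ 2 := sum_nonneg fun _ _ => sum_nonneg fun _ _ => sq_nonneg _
  have hT : 0 ≤ ∑ τ, (∑ i ∈ P, m i i τ) ^ 2 := sum_nonneg fun _ _ => sq_nonneg _
  have key := hm.card_sub_one_mul_sum_sq hc
  rcases Nat.lt_or_ge #P 2 with h | h
  · interval_cases hP : #P
    · rw [card_eq_zero] at hP
      subst hP
      simp
    · obtain ⟨i, rfl⟩ := card_eq_one.1 hP
      simp only [sum_singleton] at hS ⊢
      constructor <;> linarith
  · have h2 : (2 : ℝ) ≤ #P := by exact_mod_cast h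
    constructor <;> nlinarith

theorem IsKernel.sum_sq_add_bounds (hm : IsKernel P m) (hc : IsCentred P m) {h : Perm V → ℝ}
    (hh : IsBlind P h) :
    ∑ τ, h τ ^ 2 + ∑ i ∈ P, ∑ τ, m i i τ ^ 2 ≤ ∑ τ, (h τ + ∑ i ∈ P, m i i τ) ^ 2 ∧
      ∑ τ, (h τ + ∑ i ∈ P, m i i τ) ^ 2 ≤ ∑ τ, h τ ^ 2 + 2 * ∑ i ∈ P, ∑ τ, m i i τ ^ 2 := by
  have h1 : ∑ τ, (h τ + ∑ i ∈ P, m i i τ) ^ 2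
      = ∑ τ, h τ ^ 2 + ∑ τ, (∑ i ∈ P, m i i τ) ^ 2 := by
    have e : ∀ τ, (h τ + ∑ i ∈ P, m i i τ) ^ 2
        = h τ ^ 2 + (∑ i ∈ P, m i i τ) ^ 2 + 2 * ∑ i ∈ P, h τ * m i i τ := by
      intro τ; rw [← mul_sum]; ring
    simp only [e, sum_add_distrib, ← mul_sum (s := (univ : Finset (Perm V)))]
    rw [sum_comm, sum_eq_zero fun i hi => hm.sum_blind_mul_eq_zero hc hh hi]
    ring
  have := hm.sum_sq_bounds hc
  rw [h1]
  constructor <;> linarith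

/-- The doubly centred part of a kernel. -/
noncomputable def centre (P : Finset V) (m : V → V → Perm V → ℝ) (i k : V) (τ : Perm V) : ℝ :=
  m i k τ - (∑ j ∈ P, m j k τ) / #P - (∑ l ∈ P, m i l τ) / #P
    + (∑ j ∈ P, ∑ l ∈ P, m j l τ) / #P ^ 2

/-- The conditional mean, given the occupied sites, of the diagonal sum of a kernel. -/
noncomputable def blindPart (P : Finset V) (m : V → V → Perm V → ℝ) (τ : Perm V) : ℝ :=
  (∑ j ∈ P, ∑ l ∈ P, m j l τ) / #P

theorem sum_apply_of_preserves {V : Type*} {P : Finset V} {ρ : Perm V} (hρ : ∀ i, ρ i ∈ P ↔ i ∈ P) (g : V → ℝ) :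
    ∑ l ∈ P, g (ρ l) = ∑ l ∈ P, g l :=
  sum_equiv ρ (fun i => (hρ i).symm) fun _ _ => rfl

theorem IsKernel.centre {V : Type*} {P : Finset V} {m : V → V → Perm V → ℝ}
    (hm : IsKernel P m) : IsKernel P (centre P m) := by
  intro ρ hρ i k τ
  have h1 : ∀ j, ∑ l ∈ P, m j l (τ * ρ) = ∑ l ∈ P, m j l τ := fun j => by
    simp only [hm ρ hρ]; exact sum_apply_of_preserves hρ fun l => m j l τ
  simp only [APLG.centre, h1]
  simp only [hm ρ hρ]

theorem IsKernel.isBlind_blindPart {V : Type*} {P : Finset V} {m : V → V → Perm V → ℝ}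
    (hm : IsKernel P m) : IsBlind P (blindPart P m) := by
  intro ρ hρ τ
  have h1 : ∀ j, ∑ l ∈ P, m j l (τ * ρ) = ∑ l ∈ P, m j l τ := fun j => by
    simp only [hm ρ hρ]; exact sum_apply_of_preserves hρ fun l => m j l τ
  simp only [blindPart, h1]

theorem isCentred_centre {V : Type*} {P : Finset V} (hP : P.Nonempty) (m : V → V → Perm V → ℝ) :
    IsCentred P (centre P m) := by
  have hK : (#P : ℝ) ≠ 0 := by exact_mod_cast hP.card_pos.ne'
  constructor
  · intro i _ τ
    simp only [centre, sum_add_distrib, sum_sub_distrib, sum_const, nsmul_eq_mul, ← sum_div]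
    rw [sum_comm]
    field_simp
    ring
  · intro k _ τ
    simp only [centre, sum_add_distrib, sum_sub_distrib, sum_const, nsmul_eq_mul, ← sum_div]
    field_simp
    ring

theorem blindPart_add_sum_centre {V : Type*} {P : Finset V} (hP : P.Nonempty) (m : V → V → Perm V → ℝ) (τ : Perm V) :
    blindPart P m τ + ∑ i ∈ P, centre P m i i τ = ∑ i ∈ P, m i i τ := by
  have hK : (#P : ℝ) ≠ 0 := by exact_mod_cast hP.card_pos.ne'
  simp only [centre, blindPart, sum_add_distrib, sum_sub_distrib, sum_const, nsmul_eq_mul,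
    ← sum_div]
  rw [sum_comm (s := P) (t := P) (f := fun i j => m j i τ)]
  field_simp
  ring

variable {R : V → V → Prop} [DecidableRel R]

theorem jumpEnergy_eq (P : Finset V) (Φ : Perm V → ℝ) :
    jumpEnergy R P Φ = ∑ u, ∑ v, ∑ τ : Perm V,
      (if R u v ∧ τ⁻¹ u ∈ P ∧ τ⁻¹ v ∉ P then Φ (swap u v * τ) - Φ τ else 0) ^ 2 := by
  unfold jumpEnergy
  rw [sum_comm]
  refine sum_congr rfl fun u _ => ?_
  rw [sum_comm]
  refine sum_congr rfl fun v _ => sum_congr rfl fun τ _ => ?_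
  split_ifs <;> simp

/-- For a fixed bond `u, v`, whether the jump is allowed depends on the occupied set only. The
increments thus form again a centred kernel and a blind function, and the lower bound on norms
applies to them. -/
theorem IsKernel.jumpEnergy_add_le (hm : IsKernel P m) (hc : IsCentred P m) {h : Perm V → ℝ}
    (hh : IsBlind P h) :
    jumpEnergy R P h + ∑ i ∈ P, jumpEnergy R P (fun τ => m i i τ)
      ≤ jumpEnergy R P fun τ => h τ + ∑ i ∈ P, m i i τ := by
  simp only [jumpEnergy_eq]
  rw [sum_comm (s := P), ← sum_add_distrib]
  refine sum_le_sum fun u _ => ?_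
  rw [sum_comm (s := P), ← sum_add_distrib]
  refine sum_le_sum fun v _ => ?_
  have hinv : ∀ ρ : Perm V, (∀ i, ρ i ∈ P ↔ i ∈ P) → ∀ (τ : Perm V) (w : V),
      (τ * ρ)⁻¹ w ∈ P ↔ τ⁻¹ w ∈ P := by
    intro ρ hρ τ w
    rw [← hρ ((τ * ρ)⁻¹ w), mul_inv_rev, Perm.mul_apply]
    simp
  let m' : V → V → Perm V → ℝ := fun i k τ =>
    if R u v ∧ τ⁻¹ u ∈ P ∧ τ⁻¹ v ∉ P then m i k (swap u v * τ) - m i k τ else 0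
  let h' : Perm V → ℝ := fun τ =>
    if R u v ∧ τ⁻¹ u ∈ P ∧ τ⁻¹ v ∉ P then h (swap u v * τ) - h τ else 0
  have hm' : IsKernel P m' := by
    intro ρ hρ i k τ
    simp only [m', hinv ρ hρ, ← mul_assoc, hm ρ hρ]
  have hh' : IsBlind P h' := by
    intro ρ hρ τ
    simp only [h', hinv ρ hρ, ← mul_assoc, hh ρ hρ]
  have hc' : IsCentred P m' := by
    constructor
    · intro i hi τ
      simp only [m']
      split_ifs
      · rw [sum_sub_distrib, hc.row i hi, hc.row i hi, sub_zero]
      · simp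
    · intro k hk τ
      simp only [m']
      split_ifs
      · rw [sum_sub_distrib, hc.col k hk, hc.col k hk, sub_zero]
      · simp
  refine (hm'.sum_sq_add_bounds hc' hh').1.trans (le_of_eq ?_)
  refine sum_congr rfl fun τ _ => ?_
  simp only [m', h']
  split_ifs
  · rw [sum_sub_distrib]; ring
  · simp

/-- The Poincaré inequality for the sums over the particles of functions of one particle and of
the set of the occupied sites. -/
theorem IsGridLike.kernel_poincare {n : ℕ} (hG : IsGridLike R n) (hP : P.Nonempty) {β : ℝ}
    (hβ0 : 0 < β) (hβ1 : β ≤ 1) (hβ : β * Fintype.card V ≤ #Pᶜ) (hm : IsKernel P m)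
    (hmean : ∑ τ, ∑ i ∈ P, m i i τ = 0) :
    ∑ τ, (∑ i ∈ P, m i i τ) ^ 2
      ≤ 40000000 / β * n ^ 2 * jumpEnergy R P fun τ => ∑ i ∈ P, m i i τ := by
  obtain ⟨i₀, hi₀⟩ := hP
  have hP : P.Nonempty := ⟨i₀, hi₀⟩
  have hM := hm.centre
  have hc := isCentred_centre hP m
  have hh := hm.isBlind_blindPart
  have hf := blindPart_add_sum_centre hP m
  have hMmean : ∀ i ∈ P, ∑ τ, APLG.centre P m i i τ = 0 := fun i hi => by
    simpa using hM.sum_blind_mul_eq_zero hc (h := fun _ => 1) (fun _ _ _ => rfl) hi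
  have hhmean : ∑ τ, blindPart P m τ = 0 := by
    have : ∑ τ, (blindPart P m τ + ∑ i ∈ P, APLG.centre P m i i τ) = 0 := by
      simp only [hf]; exact hmean
    rw [sum_add_distrib, sum_comm, sum_eq_zero hMmean] at this
    linarith
  have b1 := hG.tagged_poincare hi₀ hβ0 hβ1 hβ (Φ := blindPart P m)
    (fun ρ hρ _ τ => hh ρ hρ τ) hhmean
  have b2 : ∀ i ∈ P, ∑ τ, APLG.centre P m i i τ ^ 2
      ≤ 20000000 / β * n ^ 2 * jumpEnergy R P fun τ => APLG.centre P m i i τ := fun i hi =>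
    hG.tagged_poincare hi hβ0 hβ1 hβ
      (fun ρ hρ hi' τ => by rw [hM ρ hρ, hi']) (hMmean i hi)
  have b3 := sum_le_sum b2
  rw [← mul_sum] at b3
  have b4 := (hM.sum_sq_add_bounds hc hh).2
  have b5 := hM.jumpEnergy_add_le (R := R) hc hh
  simp only [hf] at b4 b5
  have hC : 0 ≤ 20000000 / β * (n : ℝ) ^ 2 := by positivity
  have b6 := mul_le_mul_of_nonneg_left b5 hC
  have b7 : 0 ≤ 20000000 / β * (n : ℝ) ^ 2 * jumpEnergy R P (blindPart P m) :=
    mul_nonneg hC (jumpEnergy_nonneg R P _)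
  have e : 40000000 / β * (n : ℝ) ^ 2 = 2 * (20000000 / β * (n : ℝ) ^ 2) := by ring
  rw [e, mul_assoc]
  linarith

end Kernels

/-! ### From configurations to permutations. -/

theorem isGridLike_boxAdj {n : ℕ} (hn : 1 ≤ n) : IsGridLike (boxAdj n) n where
  one_le := hn
  card_eq := by rw [Fintype.card_coe, card_box]
  symm _ _ h := h.symm
  irrefl _ h := h.ne rfl
  exists_adj := exists_neighbour hn
  card_adj_le := card_neighbours_le
  sum_sq_le _ hs := hs.sum_sq_le_energy
  sum_sq_le_compl _ _ hs := hs.sum_sq_le_energy_compl hn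
  sq_le_compl _ _ hs _ _ hp hq := hs.sq_le_energy_compl hn hp hq
  sq_le_detour _ _ hs _ _ hp hq := hs.sq_le_energy_detour hn hp hq

/-- Whether a site is occupied. -/
def Site.isOcc : Site → Bool
  | empty => false
  | _ => true

theorem Site.eta_eq (s : Site) : s.eta = if s.isOcc then 1 else 0 := by
  cases s <;> simp [Site.eta, Site.etaA, Site.etaP, Site.isOcc]

theorem Site.eq_empty_of_isOcc {s : Site} (h : s.isOcc = false) : s = Site.empty := by
  cases s <;> simp_all [Site.isOcc]

theorem Site.card_angles (s : Site) :
    s.activeAngles.card + s.passiveAngles.card = if s.isOcc then 1 else 0 := by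
  cases s <;> simp [Site.activeAngles, Site.passiveAngles, Site.isOcc]

/-- The occupied sites of a configuration. -/
def occ {ι : Type} [Fintype ι] (η : Config ι) : Finset ι := {x | (η x).isOcc}

theorem mem_occ {ι : Type} [Fintype ι] {η : Config ι} {x : ι} :
    x ∈ occ η ↔ (η x).isOcc := by simp [occ]

theorem exists_perm_comp_eq {ι α : Type*} [Fintype ι] [DecidableEq α] {η ξ : ι → α}
    (h : ∀ a, #{x | η x = a} = #{x | ξ x = a}) : ∃ σ : Perm ι, η = ξ ∘ σ := by
  have he : ∀ a, Nonempty ({x // η x = a} ≃ {x // ξ x = a}) := fun a => by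
    rw [← Fintype.card_eq, Fintype.card_subtype, Fintype.card_subtype]
    exact h a
  let e : ∀ a, {x // η x = a} ≃ {x // ξ x = a} := fun a => (he a).some
  refine ⟨(Equiv.sigmaFiberEquiv η).symm.trans ((Equiv.sigmaCongrRight e).trans
    (Equiv.sigmaFiberEquiv ξ)), ?_⟩
  funext x
  simp only [Function.comp_apply, Equiv.trans_apply]
  exact ((e (η x) ⟨x, rfl⟩).2).symm

open Classical in
theorem card_fibre_eq {ι : Type} [Fintype ι] {η ξ : Config ι}
    (ha : ∑ x, (η x).activeAngles = ∑ x, (ξ x).activeAngles)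
    (hp : ∑ x, (η x).passiveAngles = ∑ x, (ξ x).passiveAngles) (s : Site) :
    #{x | η x = s} = #{x | ξ x = s} := by
  have hA : ∀ (ζ : Config ι) (θ : Real.Angle),
      #{x | ζ x = Site.active θ} = (∑ x, (ζ x).activeAngles).count θ := by
    intro ζ θ
    rw [Multiset.count_sum', card_filter]
    refine sum_congr rfl fun x _ => ?_
    cases ζ x <;> simp [Site.activeAngles, Multiset.count_singleton, eq_comm]
  have hP : ∀ (ζ : Config ι) (θ : Real.Angle),
      #{x | ζ x = Site.passive θ} = (∑ x, (ζ x).passiveAngles).count θ := by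
    intro ζ θ
    rw [Multiset.count_sum', card_filter]
    refine sum_congr rfl fun x _ => ?_
    cases ζ x <;> simp [Site.passiveAngles, Multiset.count_singleton, eq_comm]
  have hE : ∀ ζ : Config ι, #{x | ζ x = Site.empty} + (∑ x, (ζ x).activeAngles).card
      + (∑ x, (ζ x).passiveAngles).card = Fintype.card ι := by
    intro ζ
    rw [Multiset.card_sum, Multiset.card_sum, card_filter, ← sum_add_distrib, ← sum_add_distrib,
      Fintype.card_eq_sum_ones]
    refine sum_congr rfl fun x _ => ?_
    cases ζ x <;> simp [Site.activeAngles, Site.passiveAngles]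
  cases s with
  | empty =>
    have h1 := hE η
    have h2 := hE ξ
    rw [ha, hp] at h1
    omega
  | active θ => rw [hA, hA, ha]
  | passive θ => rw [hP, hP, hp]

theorem card_occ {ι : Type} [Fintype ι] (η : Config ι) :
    #(occ η) = (∑ x, (η x).activeAngles).card + (∑ x, (η x).passiveAngles).card := by
  rw [Multiset.card_sum, Multiset.card_sum, ← sum_add_distrib, occ, card_filter]
  exact sum_congr rfl fun x _ => (Site.card_angles _).symm

/-- The fibres of `τ ↦ ξ ∘ τ⁻¹` are cosets of the stabiliser of `ξ`, hence of equal size. -/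
theorem sum_orbit_div {ι α : Type*} [Fintype ι] [DecidableEq ι] {H : Finset (ι → α)} {ξ : ι → α}
    (hmem : ∀ τ : Perm ι, ξ ∘ ⇑τ⁻¹ ∈ H) (htrans : ∀ η ∈ H, ∃ σ : Perm ι, η = ξ ∘ σ)
    (g : (ι → α) → ℝ) :
    (∑ η ∈ H, g η) / #H = (∑ τ : Perm ι, g (ξ ∘ ⇑τ⁻¹)) / Fintype.card (Perm ι) := by
  classical
  set c : ℝ := (#{τ : Perm ι | ξ ∘ ⇑τ⁻¹ = ξ} : ℝ) with hc
  have hc0 : 0 < c := by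
    have : (1 : Perm ι) ∈ ({τ : Perm ι | ξ ∘ ⇑τ⁻¹ = ξ} : Finset (Perm ι)) :=
      mem_filter.2 ⟨mem_univ _, rfl⟩
    rw [hc]
    exact_mod_cast card_pos.2 ⟨1, this⟩
  have hfib : ∀ η ∈ H, (#{τ : Perm ι | ξ ∘ ⇑τ⁻¹ = η} : ℝ) = c := by
    intro η hη
    obtain ⟨σ, rfl⟩ := htrans η hη
    rw [hc]
    congr 1
    refine card_equiv (Equiv.mulLeft σ) fun τ => ?_
    simp only [mem_filter, mem_univ, true_and, Equiv.coe_mulLeft, mul_inv_rev]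
    constructor
    · intro h
      funext x
      have := congrFun h (σ⁻¹ x)
      simpa using this
    · intro h
      funext x
      have := congrFun h (σ x)
      simpa using this
  have hsum : ∀ g : (ι → α) → ℝ, ∑ τ : Perm ι, g (ξ ∘ ⇑τ⁻¹) = c * ∑ η ∈ H, g η := by
    intro g
    rw [← sum_fiberwise_of_maps_to (s := univ) (t := H) (g := fun τ : Perm ι => ξ ∘ ⇑τ⁻¹)
      fun τ _ => hmem τ, mul_sum]
    refine sum_congr rfl fun η hη => ?_
    rw [← hfib η hη, ← nsmul_eq_mul, ← sum_const]
    refine sum_congr rfl fun τ hτ => ?_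
    rw [(mem_filter.1 hτ).2]
  have h1 := hsum fun _ => 1
  simp only [sum_const, nsmul_eq_mul, mul_one, card_univ] at h1
  rw [hsum, h1, mul_div_mul_left _ _ hc0.ne']

theorem CanonicalState.expect_eq {n : ℕ} (K : CanonicalState n) {ξ : Config (box n)}
    (hξ : ξ ∈ K.hyperplane) (g : Config (box n) → ℝ) :
    K.expect g = (∑ τ : Perm (box n), g (ξ ∘ ⇑τ⁻¹)) / Fintype.card (Perm (box n)) := by
  classical
  unfold CanonicalState.expect
  refine sum_orbit_div (fun τ => ?_) (fun η hη => ?_) g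
  · rw [Set.Finite.mem_toFinset]
    exact ⟨(Equiv.sum_comp τ⁻¹ fun x => (ξ x).activeAngles).trans hξ.1,
      (Equiv.sum_comp τ⁻¹ fun x => (ξ x).passiveAngles).trans hξ.2⟩
  · rw [Set.Finite.mem_toFinset] at hη
    exact exists_perm_comp_eq (card_fibre_eq (hη.1.trans hξ.1.symm) (hη.2.trans hξ.2.symm))

/-- Reversibility: `τ ↦ swap x y * τ` exchanges a jump with its reverse. Each term and its image add
up to a squared increment, whence the factor 1/2. -/
theorem sum_mul_neg_generator_eq {V : Type*} [Fintype V] [DecidableEq V] {R : V → V → Prop}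
    [DecidableRel R] (hR : ∀ p q, R p q → R q p) (P : Finset V) (Φ : Perm V → ℝ) :
    ∑ τ : Perm V, Φ τ * -(∑ x, ∑ y, if R x y ∧ τ⁻¹ x ∈ P ∧ τ⁻¹ y ∉ P then
      Φ (swap x y * τ) - Φ τ else 0) = jumpEnergy R P Φ / 2 := by
  let c : Perm V → V → V → ℝ := fun τ x y => if R x y ∧ τ⁻¹ x ∈ P ∧ τ⁻¹ y ∉ P then 1 else 0
  have hT : ∑ τ : Perm V, Φ τ * -(∑ x, ∑ y, if R x y ∧ τ⁻¹ x ∈ P ∧ τ⁻¹ y ∉ P then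
      Φ (swap x y * τ) - Φ τ else 0)
      = ∑ x, ∑ y, ∑ τ, c τ x y * (Φ τ * (Φ τ - Φ (swap x y * τ))) := by
    have : ∀ τ : Perm V, Φ τ * -(∑ x, ∑ y, if R x y ∧ τ⁻¹ x ∈ P ∧ τ⁻¹ y ∉ P then
        Φ (swap x y * τ) - Φ τ else 0)
        = ∑ x, ∑ y, c τ x y * (Φ τ * (Φ τ - Φ (swap x y * τ))) := by
      intro τ
      rw [← sum_neg_distrib, mul_sum]
      refine sum_congr rfl fun x _ => ?_
      rw [← sum_neg_distrib, mul_sum]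
      refine sum_congr rfl fun y _ => ?_
      simp only [c]
      split_ifs <;> ring
    simp only [this]
    rw [sum_comm]
    exact sum_congr rfl fun x _ => sum_comm
  have hc : ∀ τ x y, c (swap x y * τ) x y = c τ y x := by
    intro τ x y
    have : R x y ↔ R y x := ⟨hR x y, hR y x⟩
    simp only [c, mul_inv_rev, swap_inv, Perm.mul_apply, swap_apply_left, swap_apply_right, this]
  have hT' : ∑ x, ∑ y, ∑ τ, c τ x y * (Φ τ * (Φ τ - Φ (swap x y * τ)))
      = ∑ x, ∑ y, ∑ τ, c τ x y * (Φ (swap x y * τ) * (Φ (swap x y * τ) - Φ τ)) := by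
    rw [sum_comm]
    refine sum_congr rfl fun y _ => sum_congr rfl fun x _ => ?_
    rw [← Equiv.sum_comp (Equiv.mulLeft (swap x y))]
    refine sum_congr rfl fun τ _ => ?_
    simp only [Equiv.coe_mulLeft, swap_mul_self_mul]
    rw [hc, swap_comm x y]
  have hJ : jumpEnergy R P Φ = ∑ x, ∑ y, ∑ τ, c τ x y * (Φ τ * (Φ τ - Φ (swap x y * τ)))
      + ∑ x, ∑ y, ∑ τ, c τ x y * (Φ (swap x y * τ) * (Φ (swap x y * τ) - Φ τ)) := by
    simp only [jumpEnergy_eq, ← sum_add_distrib]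
    refine sum_congr rfl fun x _ => sum_congr rfl fun y _ => sum_congr rfl fun τ _ => ?_
    simp only [c]
    split_ifs <;> ring
  rw [hT, hJ, ← hT']
  ring

theorem sum_mul_neg_config_eq {ι : Type} [Fintype ι] [DecidableEq ι] {R : ι → ι → Prop}
    [DecidableRel R] (hR : ∀ p q, R p q → R q p) (ξ : Config ι) (g : Config ι → ℝ) :
    ∑ τ : Perm ι, g (ξ ∘ ⇑τ⁻¹) * -(∑ x, ∑ y, if R x y then
      ((ξ ∘ ⇑τ⁻¹) x).eta * (1 - ((ξ ∘ ⇑τ⁻¹) y).eta)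
        * (g ((ξ ∘ ⇑τ⁻¹) ∘ swap x y) - g (ξ ∘ ⇑τ⁻¹)) else 0)
      = jumpEnergy R (occ ξ) (fun τ => g (ξ ∘ ⇑τ⁻¹)) / 2 := by
  rw [← sum_mul_neg_generator_eq hR]
  refine sum_congr rfl fun τ _ => ?_
  congr 2
  refine sum_congr rfl fun x _ => sum_congr rfl fun y _ => ?_
  have hsw : (ξ ∘ ⇑τ⁻¹) ∘ ⇑(swap x y) = ξ ∘ ⇑(swap x y * τ)⁻¹ := by
    rw [mul_inv_rev, swap_inv, Perm.coe_mul]; rfl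
  rw [hsw, Site.eta_eq, Site.eta_eq]
  simp only [mem_occ, Function.comp_apply]
  by_cases h : R x y
  · by_cases h1 : (ξ (τ⁻¹ x)).isOcc <;> by_cases h2 : (ξ (τ⁻¹ y)).isOcc <;>
      simp only [h, h1, h2, if_true] <;> simp
  · simp [h]

theorem dirichletForm_eq {n : ℕ} (K : CanonicalState n) {ξ : Config (box n)}
    (hξ : ξ ∈ K.hyperplane) (g : Config (box n) → ℝ) :
    dirichletForm K g = jumpEnergy (boxAdj n) (occ ξ) (fun τ => g (ξ ∘ ⇑τ⁻¹)) / 2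
      / Fintype.card (Perm (box n)) := by
  have h := sum_mul_neg_config_eq (R := boxAdj n) (fun _ _ h => h.symm) ξ g
  rw [dirichletForm, K.expect_eq hξ]
  exact congrArg (· / (Fintype.card (Perm (box n)) : ℝ)) h

/-! ### The class `T^ω` on the box. -/

/-- Blindness is a condition at one site, so types and angles are changed site by site; this reaches
finitely many sites only, hence `s`. An empty site has a single state and needs no change. -/
theorem eq_of_mem_blindFunctions {F : ConfigZ2 → ℝ} (hF : F ∈ blindFunctions)
    (s : Finset (ℤ × ℤ)) : ∀ η η' : ConfigZ2, (∀ x, (η x).isOcc = (η' x).isOcc) →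
      (∀ x, x ∉ s → η x = η' x) → F η = F η' := by
  induction s using Finset.induction_on with
  | empty =>
    intro η η' _ h
    rw [show η = η' from funext fun x => h x (notMem_empty x)]
  | insert a s _ ih =>
    intro η η' hocc h
    have h1 : F η = F (Function.update η a (η' a)) := by
      cases hb : (η a).isOcc with
      | false =>
        have e1 := Site.eq_empty_of_isOcc hb
        have e2 := Site.eq_empty_of_isOcc ((hocc a).symm.trans hb)
        rw [e2, ← e1, Function.update_eq_self]
      | true =>
        obtain ⟨f, g, hf, hfg⟩ := hF a
        have hb' : (η' a).isOcc = true := (hocc a).symm.trans hb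
        rw [hfg, hfg, Function.update_self, Site.eta_eq, Site.eta_eq, hb, hb']
        have : f η = f (Function.update η a (η' a)) := hf fun x hx =>
          (Function.update_of_ne hx _ _).symm
        simp [this]
    rw [h1]
    refine ih _ _ (fun x => ?_) fun x hx => ?_
    · by_cases hxa : x = a
      · subst hxa; simp
      · simp [hxa, hocc x]
    · by_cases hxa : x = a
      · subst hxa; simp
      · rw [Function.update_of_ne hxa]
        exact h x (by simp [hxa, hx])

/-- The extension of a configuration on the box by empty sites. -/
noncomputable def extend {n : ℕ} (η : Config (box n)) : ConfigZ2 :=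
  fun x => if h : x ∈ box n then η ⟨x, h⟩ else Site.empty

open Classical in
/-- The configuration with an active particle of angle `0` at the sites of `A`. -/
noncomputable def indicatorConfig {n : ℕ} (A : Finset (box n)) : Config (box n) :=
  fun x => if x ∈ A then Site.active 0 else Site.empty

theorem apply_extend_eq {n : ℕ} {F : ConfigZ2 → ℝ} (hF : F ∈ blindFunctions)
    (η : Config (box n)) : F (extend η) = F (extend (indicatorConfig (occ η))) := by
  refine eq_of_mem_blindFunctions hF (box n) _ _ (fun x => ?_) fun x hx => by simp [extend, hx]
  by_cases hx : x ∈ box n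
  · have h1 : extend η x = η ⟨x, hx⟩ := by simp [extend, hx]
    have h2 : extend (indicatorConfig (occ η)) x = indicatorConfig (occ η) ⟨x, hx⟩ := by
      simp [extend, hx]
    rw [h1, h2, indicatorConfig]
    cases hb : (η ⟨x, hx⟩).isOcc
    · rw [if_neg (by simp [mem_occ, hb])]; rfl
    · rw [if_pos (by simp [mem_occ, hb])]; rfl
  · simp [extend, hx]

/-- A function of the class `T^ω` is on the box a sum over the particles of functions of the state
of the particle, of its position, and of the set of the occupied sites. -/
theorem exists_onBox_eq_sum {ω : Real.Angle → ℝ} {f : ConfigZ2 → ℝ} (hf : f ∈ classT ω) (n : ℕ) :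
    ∃ g : Site → box n → Finset (box n) → ℝ, (∀ x A, g Site.empty x A = 0) ∧
      ∀ η : Config (box n), onBox n f η = ∑ x, g (η x) x (occ η) := by
  induction hf using Submodule.span_induction with
  | mem f hf =>
    obtain ⟨_, a, b, c, d, F, hF, hsum⟩ := hf
    refine ⟨fun s x A => (a * s.etaA + b * s.etaP + c * (ω s.angle * s.etaA)
      + d * (ω s.angle * s.etaP)) * F x.1 (extend (indicatorConfig A)),
      fun x A => by simp [Site.etaA, Site.etaP], fun η => ?_⟩
    have h1 := hsum (extend η)
    have h2 := h1.unique (hasSum_sum_of_ne_finset_zero (s := box n) fun x hx => by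
      simp [extend, hx, Site.etaA, Site.etaP])
    have h3 : onBox n f η = f (extend η) := rfl
    rw [h3, h2, ← Finset.sum_coe_sort]
    refine sum_congr rfl fun x _ => ?_
    have h4 : extend η x.1 = η x := by simp [extend]
    rw [h4, apply_extend_eq (hF x.1) η]
  | zero => exact ⟨fun _ _ _ => 0, fun _ _ => rfl, fun η => by simp [onBox]⟩
  | add f₁ f₂ _ _ h₁ h₂ =>
    obtain ⟨g₁, h₁, e₁⟩ := h₁
    obtain ⟨g₂, h₂, e₂⟩ := h₂
    refine ⟨fun s x A => g₁ s x A + g₂ s x A, fun x A => by simp [h₁, h₂], fun η => ?_⟩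
    rw [sum_add_distrib, ← e₁, ← e₂]; rfl
  | smul r f _ h =>
    obtain ⟨g, h, e⟩ := h
    refine ⟨fun s x A => r * g s x A, fun x A => by simp [h], fun η => ?_⟩
    rw [← mul_sum, ← e]; rfl

theorem sum_comp_inv_eq {ι : Type} [Fintype ι] {g : Site → ι → Finset ι → ℝ}
    (hg : ∀ x A, g Site.empty x A = 0) (ξ : Config ι) (τ : Perm ι) :
    ∑ x, g ((ξ ∘ ⇑τ⁻¹) x) x (occ (ξ ∘ ⇑τ⁻¹))
      = ∑ i ∈ occ ξ, g (ξ i) (τ i) (occ (ξ ∘ ⇑τ⁻¹)) := by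
  rw [← Equiv.sum_comp τ]
  have h : ∀ i, (ξ ∘ ⇑τ⁻¹) (τ i) = ξ i := fun i => by simp
  simp only [h]
  symm
  refine sum_subset (subset_univ _) fun i _ hi => ?_
  rw [mem_occ, Bool.not_eq_true] at hi
  rw [Site.eq_empty_of_isOcc hi, hg]

theorem isKernel_of_config {ι : Type} [Fintype ι] [DecidableEq ι]
    (g : Site → ι → Finset ι → ℝ) (ξ : Config ι) :
    IsKernel (occ ξ) fun i k τ => g (ξ i) (τ k) (occ (ξ ∘ ⇑τ⁻¹)) := by
  intro ρ hρ i k τ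
  have : occ (ξ ∘ ⇑(τ * ρ)⁻¹) = occ (ξ ∘ ⇑τ⁻¹) := by
    ext x
    have h := hρ ((τ * ρ)⁻¹ x)
    simp only [mem_occ, Function.comp_apply] at h ⊢
    rw [← h]
    simp
  simp only [this, Perm.mul_apply]

end APLG

theorem proposition5p6 (α' : ℝ) (hα0 : 0 ≤ α') (hα1 : α' < 1) :
    ∃ C : ℝ, ∀ (ω : Real.Angle → ℝ) (n : ℕ) (K : APLG.CanonicalState n),
      K.alphaA + K.alphaP ≤ α' →
      ∀ f ∈ APLG.classTn ω n,
        K.expect (APLG.onBox n f) = 0 →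
        K.expect (fun η => APLG.onBox n f η ^ 2)
          ≤ C * (n : ℝ) ^ 2 * APLG.dirichletForm K (APLG.onBox n f) := by
  open APLG Finset Equiv in
  -- Twice the constant of `IsGridLike.kernel_poincare`, because the Dirichlet form is half the jump
  -- energy.
  refine ⟨80000000 / (1 - α'), fun ω n K hα f hf hmean => ?_⟩
  obtain ⟨ξ, hξ⟩ := K.hyperplane_nonempty
  obtain ⟨g, hg, hfg⟩ := exists_onBox_eq_sum hf.1 n
  have hβ : 0 < 1 - α' := by linarith
  have hF : (0 : ℝ) < Fintype.card (Perm (box n)) := by exact_mod_cast Fintype.card_pos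
  -- Only the diagonal enters `f`; the entry `i k` gives the state of particle `i` the position of
  -- `k`, as needed for the centring.
  let m : box n → box n → Perm (box n) → ℝ := fun i k τ => g (ξ i) (τ k) (occ (ξ ∘ ⇑τ⁻¹))
  have hfm : ∀ τ : Perm (box n), onBox n f (ξ ∘ ⇑τ⁻¹) = ∑ i ∈ occ ξ, m i i τ := fun τ => by
    rw [hfg, sum_comp_inv_eq hg]
  rw [dirichletForm_eq K hξ, K.expect_eq hξ]
  rw [K.expect_eq hξ, div_eq_zero_iff, or_iff_left hF.ne'] at hmean
  simp only [hfm] at hmean ⊢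
  rcases (occ ξ).eq_empty_or_nonempty with h0 | hP
  · have hJ := jumpEnergy_nonneg (boxAdj n) (occ ξ) fun τ => ∑ i ∈ occ ξ, m i i τ
    have h1 : ∑ τ : Perm (box n), (∑ i ∈ occ ξ, m i i τ) ^ 2 = 0 := by simp [h0]
    rw [h1, zero_div]
    exact mul_nonneg (mul_nonneg (div_nonneg (by norm_num) hβ.le) (sq_nonneg _))
      (div_nonneg (div_nonneg hJ zero_le_two) hF.le)
  have hN : (0 : ℝ) < #(box n) := by rw [card_box]; positivity
  have hK : (#(occ ξ) : ℝ) ≤ α' * #(box n) := by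
    rw [CanonicalState.alphaA, CanonicalState.alphaP, ← add_div, div_le_iff₀ hN] at hα
    rw [card_occ, hξ.1, hξ.2]
    push_cast
    exact hα
  -- A single site at density below 1 is empty, so `n = 0` belongs to the case already settled.
  have hn : 1 ≤ n := by
    by_contra h
    have hn0 : n = 0 := by omega
    subst hn0
    have h1 : (1 : ℝ) ≤ #(occ ξ) := by exact_mod_cast hP.card_pos
    rw [card_box] at hK
    norm_num at hK
    linarith
  have hcompl : (1 - α') * Fintype.card (box n) ≤ #(occ ξ)ᶜ := by
    rw [card_compl, Nat.cast_sub (card_le_univ _), Fintype.card_coe]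
    linarith
  have key := (isGridLike_boxAdj hn).kernel_poincare hP hβ (by linarith) hcompl
    (isKernel_of_config g ξ) hmean
  rw [div_le_iff₀ hF]
  refine key.trans (le_of_eq ?_)
  rw [mul_assoc (80000000 / (1 - α') * (n : ℝ) ^ 2), div_mul_cancel₀ _ hF.ne']
  ring
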